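/- Let $m\le q$ be natural numbers, let $\mathbb R^{m\times q}$ carry the Frobenius norm $\|\cdot\|_F$, let $\|X\|_*$ be the nuclear norm (the sum of the singular values of $X$), let $\rho>0$, and let $$P(X):=\mathrm{Prox}_{\rho\|\cdot\|_*}(X)=\operatorname*{arg\,min}_{Z\in\mathbb R^{m\times q}}\ \rho\|Z\|_*+\tfrac12\|Z-X\|_F^2 ,$$ which is well defined (the minimizer exists and is unique for every $X$). Let $\partial P(X)$ be the Clarke generalized Jacobian of $P$ at $X$, i.e. the convex hull of the set of all limits $\lim_k P'(X^k)$ with $X^k\to X$ and $P$ differentiable at every $X^k$. Let $Y\in\mathbb R^{m\times q}$ have the singular value decomposition $$Y=U[\mathrm{Diag}(\sigma_1,\dots,\sigma_m)\ \ 0]V^{\top},\qquad V=[V_1\ \ V_2],$$ with $U\in\mathbb R^{m\times m}$, $V\in\mathbb R^{q\times q}$ orthogonal, $V_1\in\mathbb R^{q\times m}$, $V_2\in\mathbb R^{q\times(q-m)}$, and $\sigma_1\ge\dots\ge\sigma_m\ge0$. Write $x_+=\max\{x,0\}$ and let $\odot$ be the entrywise product. Then: (a) $P(Y)=U[\mathrm{Diag}((\sigma_1-\rho)_+,\dots,(\sigma_m-\rho)_+)\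 \ 0]V^{\top}$. (b) $P$ is strongly semismooth everywhere in $\mathbb R^{m\times q}$ with respect to $\partial P$. That is: $P$ is locally Lipschitz; the multifunction $\partial P$ is nonempty-valued, compact-valued and upper semicontinuous; and at every $X$ the map $P$ is directionally differentiable and $P(X+\Delta)-P(X)-\mathcal V\Delta=O(\|\Delta\|_F^2)$ as $\Delta\to0$, uniformly over $\mathcal V\in\partial P(X+\Delta)$. (c) Let $\alpha_1=\{i:\sigma_i>\rho\}$, $\alpha_2=\{i:\sigma_i=\rho\}$, $\alpha_3=\{i:\sigma_i<\rho\}$. Define the matrices $\Gamma_{\alpha\alpha},\Gamma_{\alpha\gamma}\in\mathbb R^{m\times m}$, $\Gamma_{\alpha\beta}\in\mathbb R^{m\times(q-m)}$ in blocks, with rows (and, for the first two, columns) partitioned by $\alpha_1,\alpha_2,\alpha_3$, as $$\Gamma_{\alpha\alpha}=\begin{pmatrix}1_{\alpha_1\alpha_1}&1_{\alpha_1\alpha_2}&\tau_{\alpha_1\alpha_3}\\1_{\alpha_2\alpha_1}&0&0\\\tau_{\alpha_1\alpha_3}^{\top}&0&0\end{pmatrix},\quad \Gamma_{\alpha\gamma}=\begin{pmatrix}\omega_{\alpha_1\alpha_1}&\omega_{\alpha_1\alpha_2}&\omega_{\alpha_1\alpha_3}\\\omega_{\alpha_1\alpha_2}^{\top}&0&0\\\omega_{\alpha_1\alpha_3}^{\top}&0&0\end{pmatrix},\quad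 \Gamma_{\alpha\beta}=\begin{pmatrix}\mu\\0\\0\end{pmatrix},$$ where $1_{\alpha_i\alpha_j}$ is an all-ones block, $$\tau_{ij}=\frac{\sigma_i-\rho}{\sigma_i-\sigma_j}\ (i\in\alpha_1,\,j\in\alpha_3),\qquad \omega_{ij}=\frac{\sigma_i-\rho+(\sigma_j-\rho)_+}{\sigma_i+\sigma_j}\ (i\in\alpha_1,\,1\le j\le m),\qquad \mu_{ij}=\frac{\sigma_i-\rho}{\sigma_i}\ (i\in\alpha_1,\,1\le j\le q-m).$$ Then $\Gamma_{\alpha\alpha}$ and $\Gamma_{\alpha\gamma}$ are symmetric, and the linear map $\mathcal W:\mathbb R^{m\times q}\to\mathbb R^{m\times q}$, $$\mathcal W(H)=U\Big[\Big(\Gamma_{\alpha\alpha}\odot\frac{H_1+H_1^{\top}}2+\Gamma_{\alpha\gamma}\odot\frac{H_1-H_1^{\top}}2\Big)V_1^{\top}+(\Gamma_{\alpha\beta}\odot H_2)V_2^{\top}\Big],\qquad H_1=U^{\top}HV_1,\ H_2=U^{\top}HV_2,$$ is an element of $\partial P(Y)$. -/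

import Mathlib

open Filter Topology
open scoped Matrix

attribute [local instance] Matrix.frobeniusNormedAddCommGroup Matrix.frobeniusNormedSpace

noncomputable section

namespace NuclearProx

/-! ### Nonsmooth analysis -/

section Nonsmooth

/-- `z` minimizes `y ↦ f y + ½ ‖y - x‖²`. -/
def IsProxPoint {E : Type*} [NormedAddCommGroup E] (f : E → ℝ) (x z : E) : Prop :=
  ∀ y : E, f z + 1 / 2 * ‖z - x‖ ^ 2 ≤ f y + 1 / 2 * ‖y - x‖ ^ 2

/-- The proximal mapping: the minimizer of `y ↦ f y + ½ ‖y - x‖²`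
(to be used where this minimizer exists and is unique). -/
def prox {E : Type*} [NormedAddCommGroup E] (f : E → ℝ) (x : E) : E :=
  Classical.epsilon (IsProxPoint f x)

variable {E F : Type*} [NormedAddCommGroup E] [NormedSpace ℝ E]
  [NormedAddCommGroup F] [NormedSpace ℝ F]

/-- The Bouligand subdifferential: limits of derivatives at points of differentiability
converging to `x`. -/
def bSubdifferential (f : E → F) (x : E) : Set (E →L[ℝ] F) :=
  {V | ∃ u : ℕ → E, (∀ k, DifferentiableAt ℝ f (u k)) ∧ Tendsto u atTop (𝓝 x) ∧
    Tendsto (fun k => fderiv ℝ f (u k)) atTop (𝓝 V)}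

/-- The Clarke generalized Jacobian. -/
def clarkeJacobian (f : E → F) (x : E) : Set (E →L[ℝ] F) :=
  convexHull ℝ (bSubdifferential f x)

/-- All one-sided directional derivatives of `f` at `x` exist. -/
def DirectionallyDifferentiableAt (f : E → F) (x : E) : Prop :=
  ∀ d : E, ∃ l : F, Tendsto (fun t : ℝ => t⁻¹ • (f (x + t • d) - f x)) (𝓝[>] 0) (𝓝 l)

/-- Strong semismoothness at a point with respect to a multifunction `K`: `f` is directionally
differentiable at `x`, and `f (x + h) - f x - V h = O(‖h‖²)` as `h → 0`, uniformly over
`V ∈ K (x + h)`. -/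
def StronglySemismoothAt (f : E → F) (K : E → Set (E →L[ℝ] F)) (x : E) : Prop :=
  DirectionallyDifferentiableAt f x ∧
    ∃ C : ℝ, ∃ δ > 0, ∀ h : E, ‖h‖ < δ → ∀ V ∈ K (x + h),
      ‖f (x + h) - f x - V h‖ ≤ C * ‖h‖ ^ 2

/-- Strong semismoothness on the whole space with respect to `K`, including what the notion
presupposes: `f` is locally Lipschitz, and `K` is nonempty-valued, compact-valued and upper
semicontinuous as a multifunction. -/
structure StronglySemismooth (f : E → F) (K : E → Set (E →L[ℝ] F)) : Prop where
  locallyLipschitz : LocallyLipschitz f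
  nonempty : ∀ x, (K x).Nonempty
  isCompact : ∀ x, IsCompact (K x)
  upperSemicontinuous : UpperHemicontinuous K
  stronglySemismoothAt : ∀ x, StronglySemismoothAt f K x

end Nonsmooth

/-! ### Matrices -/

/-- The nuclear norm: the sum of all (nonzero) singular values. -/
def nuclearNorm {m q : ℕ} (X : Matrix (Fin m) (Fin q) ℝ) : ℝ :=
  (Matrix.toEuclideanLin X).singularValues.sum fun _ s => s

/-- The `m × q` matrix `[Diag(s₁, …, sₘ) 0]`. -/
def diagZero {m : ℕ} (q : ℕ) (s : Fin m → ℝ) : Matrix (Fin m) (Fin q) ℝ :=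
  Matrix.of fun i j => if (i : ℕ) = (j : ℕ) then s i else 0

/-- The first `m` columns of `V`. -/
def leftCols {m q : ℕ} (hmq : m ≤ q) (V : Matrix (Fin q) (Fin q) ℝ) :
    Matrix (Fin q) (Fin m) ℝ :=
  Matrix.of fun i j => V i (Fin.castLE hmq j)

/-- The last `q - m` columns of `V`. -/
def rightCols {m q : ℕ} (hmq : m ≤ q) (V : Matrix (Fin q) (Fin q) ℝ) :
    Matrix (Fin q) (Fin (q - m)) ℝ :=
  Matrix.of fun i j => V i (Fin.cast (Nat.add_sub_of_le hmq) (Fin.natAdd m j))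

/-- Indices with `σᵢ > ρ`. -/
def alpha₁ {m : ℕ} (ρ : ℝ) (σ : Fin m → ℝ) : Set (Fin m) := {i | σ i > ρ}

/-- Indices with `σᵢ = ρ`. -/
def alpha₂ {m : ℕ} (ρ : ℝ) (σ : Fin m → ℝ) : Set (Fin m) := {i | σ i = ρ}

/-- Indices with `σᵢ < ρ`. -/
def alpha₃ {m : ℕ} (ρ : ℝ) (σ : Fin m → ℝ) : Set (Fin m) := {i | σ i < ρ}

def tau {m : ℕ} (ρ : ℝ) (σ : Fin m → ℝ) (i j : Fin m) : ℝ := (σ i - ρ) / (σ i - σ j)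

def omega {m : ℕ} (ρ : ℝ) (σ : Fin m → ℝ) (i j : Fin m) : ℝ :=
  (σ i - ρ + max (σ j - ρ) 0) / (σ i + σ j)

def mu {m : ℕ} (ρ : ℝ) (σ : Fin m → ℝ) (i : Fin m) : ℝ := (σ i - ρ) / σ i

open Classical in
/-- The block matrix with rows `[1, 1, τ]`, `[1, 0, 0]`, `[τᵀ, 0, 0]`. -/
def gammaAA {m : ℕ} (ρ : ℝ) (σ : Fin m → ℝ) : Matrix (Fin m) (Fin m) ℝ :=
  Matrix.of fun i j =>
    if i ∈ alpha₁ ρ σ then (if j ∈ alpha₃ ρ σ then tau ρ σ i j else 1)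
    else if i ∈ alpha₂ ρ σ then (if j ∈ alpha₁ ρ σ then 1 else 0)
    else (if j ∈ alpha₁ ρ σ then tau ρ σ j i else 0)

open Classical in
/-- The block matrix with rows `[ω, ω, ω]`, `[ωᵀ, 0, 0]`, `[ωᵀ, 0, 0]`. -/
def gammaAG {m : ℕ} (ρ : ℝ) (σ : Fin m → ℝ) : Matrix (Fin m) (Fin m) ℝ :=
  Matrix.of fun i j =>
    if i ∈ alpha₁ ρ σ then omega ρ σ i j
    else (if j ∈ alpha₁ ρ σ then omega ρ σ j i else 0)

open Classical in
/-- The block matrix with rows `μ` and `0`. -/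
def gammaAB {m : ℕ} (q : ℕ) (ρ : ℝ) (σ : Fin m → ℝ) : Matrix (Fin m) (Fin (q - m)) ℝ :=
  Matrix.of fun i _ => if i ∈ alpha₁ ρ σ then mu ρ σ i else 0

end NuclearProx

end

open NuclearProx

/-!
# The proximal mapping of the nuclear norm

A matrix `Z` is the proximal point of `X` as soon as `X = Z + ρ G` with `G` a subgradient of the
nuclear norm at `Z` (`IsProxCertificate`).  By the duality between the nuclear norm and
contractions, soft-thresholding of the singular values comes with such a certificate
(`isProxCertificate_of_svd`).  This gives existence, uniqueness and the explicit form
of the minimizer, and monotonicity of the subdifferential makes the proximal mapping `P`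
nonexpansive.  The Clarke Jacobian of a Lipschitz map is compact-valued and upper semicontinuous.

For the second-order estimate, fix `X₀ = U [Diag σ 0] Vᵀ` and group the singular values (extended by
zero to all `q` columns) into the blocks `> ρ`, `= ρ` and `< ρ`.  Every `X` near `X₀` can be written
as `U exp(K) ([Diag σ 0] + D) exp(-L) Vᵀ`, where the skew-symmetric matrices `K`, `L` and the block
diagonal matrix `D`, symmetric in its first two blocks, are linear functions of a parameter `H`.
This follows from the inverse function theorem, since `K`, `L` and `D` can be chosen such that the
differential at `H = 0` is `H ↦ U H Vᵀ` (`param`, `hasFDerivAt_param`).  Orthogonal changes of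
basis commute with `P`, and on a block diagonal matrix `P` shifts the first block by `-ρ`, replaces
the second one by the positive part of its perturbation, and annihilates the third one
(`isProxCertificate_block`).
So near `X₀` one has `P X = R (X, N (b X))` (`exists_prox_model`), where `R` and `b` are smooth,
`b X₀ = 0`, and `N` is the projection onto the positive semidefinite cone.  Only two properties of
`N` are needed: it is Lipschitz and positively homogeneous.  By homogeneity `N` is linear along the
ray through `b X`, and moving from `X` in the direction `X - X₀` moves `b X` along this ray up to
`O(‖X - X₀‖²)`.  This yields strong semismoothness (`stronglySemismoothAt_of_model`).  No
derivative of `N` is ever computed.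

If no singular value equals `ρ`, the middle block is empty, hence `P` is differentiable, with an
explicit derivative read off from the parametrization (`hasFDerivAt_prox`).  In
general, lower the singular values equal to `ρ` slightly: the derivatives at the resulting points
converge to the asserted element of the Clarke Jacobian (`conj_mixMap_mem_bSubdifferential`).
-/

noncomputable section

namespace NuclearProx

/-! ### Compactness and upper semicontinuity of the Clarke Jacobian -/

section Nonsmooth

/-- By Carathéodory's theorem the convex hull is a finite union of continuous images of
`stdSimplex × sᵏ`. -/
theorem isCompact_convexHull_of_isCompact {E : Type*} [NormedAddCommGroup E] [NormedSpace ℝ E]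
    [FiniteDimensional ℝ E] {s : Set E} (hs : IsCompact s) : IsCompact (convexHull ℝ s) := by
  have key : convexHull ℝ s = ⋃ k ∈ Finset.range (Module.finrank ℝ E + 2),
      (fun p : (Fin k → ℝ) × (Fin k → E) => ∑ i, p.1 i • p.2 i) ''
        (stdSimplex ℝ (Fin k) ×ˢ Set.univ.pi fun _ => s) := by
    ext x
    simp only [Set.mem_iUnion, Set.mem_image, Set.mem_prod, Finset.mem_range]
    constructor
    · intro hx
      obtain ⟨ι, hι, z, w, hz, hind, hw, hsum, hx⟩ := eq_pos_convex_span_of_mem_convexHull hx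
      refine ⟨Fintype.card ι, ?_, (w ∘ (Fintype.equivFin ι).symm, z ∘ (Fintype.equivFin ι).symm),
        ⟨⟨fun i => (hw _).le, ?_⟩, fun i _ => hz ⟨_, rfl⟩⟩, ?_⟩
      · have := hind.card_le_finrank_succ
        have := (vectorSpan ℝ (Set.range z)).finrank_le
        omega
      · rw [← hsum]
        exact (Fintype.equivFin ι).symm.sum_comp w
      · rw [← hx]
        exact (Fintype.equivFin ι).symm.sum_comp fun i => w i • z i
    · rintro ⟨k, -, p, ⟨hp1, hp2⟩, rfl⟩
      exact (convex_convexHull ℝ s).sum_mem (fun i _ => hp1.1 i) hp1.2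
        fun i _ => subset_convexHull ℝ s (hp2 i trivial)
  rw [key]
  refine (Finset.range _).isCompact_biUnion fun k _ => ?_
  refine ((isCompact_stdSimplex ℝ (Fin k)).prod (isCompact_univ_pi fun _ => hs)).image ?_
  fun_prop

variable {E F : Type*} [NormedAddCommGroup E] [NormedSpace ℝ E]
  [NormedAddCommGroup F] [NormedSpace ℝ F]

/-- A diagonal sequence shows that the Bouligand subdifferential is the intersection of the closures
of the sets of derivatives at points of shrinking balls. -/
theorem mem_bSubdifferential_iff {f : E → F} {x : E} {V : E →L[ℝ] F} :
    V ∈ bSubdifferential f x ↔ ∀ n : ℕ, V ∈ closure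
      (fderiv ℝ f '' {u | u ∈ Metric.ball x (1 / (n + 1 : ℝ)) ∧ DifferentiableAt ℝ f u}) := by
  constructor
  · rintro ⟨u, hu, hux, huV⟩ n
    refine mem_closure_of_tendsto huV ?_
    filter_upwards [hux.eventually (Metric.ball_mem_nhds x (by positivity : 0 < 1 / (n + 1 : ℝ)))]
      with k hk
    exact ⟨u k, ⟨hk, hu k⟩, rfl⟩
  · intro h
    have h1 : ∀ n : ℕ, ∃ u, u ∈ Metric.ball x (1 / (n + 1 : ℝ)) ∧ DifferentiableAt ℝ f u ∧
        dist V (fderiv ℝ f u) < 1 / (n + 1 : ℝ) := by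
      intro n
      obtain ⟨_, ⟨u, ⟨hu, hd⟩, rfl⟩, h2⟩ :=
        Metric.mem_closure_iff.1 (h n) (1 / (n + 1 : ℝ)) (by positivity)
      exact ⟨u, hu, hd, h2⟩
    choose u hu hd hV using h1
    refine ⟨u, hd, ?_, ?_⟩
    · rw [tendsto_iff_dist_tendsto_zero]
      exact squeeze_zero (fun _ => dist_nonneg) (fun n => (Metric.mem_ball.1 (hu n)).le)
        tendsto_one_div_add_atTop_nhds_zero_nat
    · rw [tendsto_iff_dist_tendsto_zero]
      exact squeeze_zero (fun _ => dist_nonneg) (fun n => (dist_comm _ _).trans_le (hV n).le)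
        tendsto_one_div_add_atTop_nhds_zero_nat

theorem bSubdifferential_eq_iInter (f : E → F) (x : E) :
    bSubdifferential f x = ⋂ n : ℕ, closure
      (fderiv ℝ f '' {u | u ∈ Metric.ball x (1 / (n + 1 : ℝ)) ∧ DifferentiableAt ℝ f u}) := by
  ext V
  rw [mem_bSubdifferential_iff, Set.mem_iInter]

section Lipschitz

variable [FiniteDimensional ℝ E] [FiniteDimensional ℝ F] {f : E → F} {K : NNReal}

theorem isCompact_closure_fderiv_image (hf : LipschitzWith K f) (s : Set E) :
    IsCompact (closure (fderiv ℝ f '' s)) := by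
  have : ProperSpace (E →L[ℝ] F) := FiniteDimensional.proper ℝ _
  refine (isCompact_closedBall (0 : E →L[ℝ] F) K).of_isClosed_subset isClosed_closure
    (closure_minimal ?_ Metric.isClosed_closedBall)
  rintro _ ⟨u, -, rfl⟩
  rw [mem_closedBall_zero_iff]
  exact norm_fderiv_le_of_lipschitz ℝ hf

theorem isCompact_bSubdifferential (hf : LipschitzWith K f) (x : E) :
    IsCompact (bSubdifferential f x) := by
  rw [bSubdifferential_eq_iInter]
  exact (isCompact_closure_fderiv_image hf _).of_isClosed_subset
    (isClosed_iInter fun n => isClosed_closure) (Set.iInter_subset _ 0)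

theorem isCompact_clarkeJacobian (hf : LipschitzWith K f) (x : E) :
    IsCompact (clarkeJacobian f x) :=
  isCompact_convexHull_of_isCompact (isCompact_bSubdifferential hf x)

/-- The sets of derivatives near `x` decrease to the Bouligand subdifferential at `x`, so by
compactness one of them lies in any given neighbourhood of it. -/
theorem eventually_bSubdifferential_subset (hf : LipschitzWith K f) {x : E}
    {O : Set (E →L[ℝ] F)} (hO : IsOpen O) (hsub : bSubdifferential f x ⊆ O) :
    ∀ᶠ y in 𝓝 x, bSubdifferential f y ⊆ O := by
  rw [bSubdifferential_eq_iInter] at hsub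
  obtain ⟨n, hn⟩ := exists_subset_nhds_of_isCompact
    (V := fun n : ℕ => closure (fderiv ℝ f ''
      {u | u ∈ Metric.ball x (1 / (n + 1 : ℝ)) ∧ DifferentiableAt ℝ f u}))
    (directed_of_isDirected_le fun i j hij => closure_mono <| Set.image_mono fun u hu =>
      ⟨Metric.ball_subset_ball (Nat.one_div_le_one_div hij) hu.1, hu.2⟩)
    (fun n => isCompact_closure_fderiv_image hf _)
    (fun V hV => hO.mem_nhds (hsub hV))
  filter_upwards [Metric.ball_mem_nhds x (by positivity : 0 < 1 / (n + 1 : ℝ))] with y hy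
  rintro V ⟨u, hu, huy, huV⟩
  apply hn
  refine mem_closure_of_tendsto huV ?_
  filter_upwards [huy.eventually (Metric.isOpen_ball.mem_nhds hy)] with k hk
  exact ⟨u k, ⟨hk, hu k⟩, rfl⟩

/-- A thickening of a convex set is convex, so it contains the convex hull of any set of limiting
derivatives which it contains. -/
theorem upperHemicontinuous_clarkeJacobian (hf : LipschitzWith K f) :
    UpperHemicontinuous (clarkeJacobian f) := by
  rw [upperHemicontinuous_iff]
  intro x
  rw [upperHemicontinuousAt_iff]
  intro t ht
  obtain ⟨U, hU, hxU, hUt⟩ := mem_nhdsSet_iff_exists.1 ht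
  obtain ⟨ε, hε, hεU⟩ := (isCompact_clarkeJacobian hf x).exists_thickening_subset_open hU hxU
  have hsub : bSubdifferential f x ⊆ Metric.thickening ε (clarkeJacobian f x) :=
    (subset_convexHull ℝ _).trans (Metric.self_subset_thickening hε _)
  filter_upwards [eventually_bSubdifferential_subset hf Metric.isOpen_thickening hsub] with y hy
  refine mem_nhdsSet_iff_exists.2 ⟨U, hU, ?_, hUt⟩
  exact (convexHull_min hy ((convex_convexHull ℝ _).thickening ε)).trans hεU

end Lipschitz

/-! ### Strong semismoothness from a local model -/

/-- It suffices to estimate at points of differentiability: the bound passes to limits of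
derivatives, and then to convex combinations. -/
theorem norm_sub_le_of_mem_clarkeJacobian {f : E → F} (hf : Continuous f) {x : E} {C δ : ℝ}
    (hC : ∀ h : E, ‖h‖ < δ → DifferentiableAt ℝ f (x + h) →
      ‖f (x + h) - f x - fderiv ℝ f (x + h) h‖ ≤ C * ‖h‖ ^ 2)
    (h : E) (hh : ‖h‖ < δ) (V : E →L[ℝ] F) (hV : V ∈ clarkeJacobian f (x + h)) :
    ‖f (x + h) - f x - V h‖ ≤ C * ‖h‖ ^ 2 := by
  have hconv : Convex ℝ {V : E →L[ℝ] F | ‖f (x + h) - f x - V h‖ ≤ C * ‖h‖ ^ 2} := by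
    have : {V : E →L[ℝ] F | ‖f (x + h) - f x - V h‖ ≤ C * ‖h‖ ^ 2} =
        (ContinuousLinearMap.apply ℝ F h).toLinearMap ⁻¹'
          Metric.closedBall (f (x + h) - f x) (C * ‖h‖ ^ 2) := by
      ext V
      simp [dist_eq_norm, norm_sub_rev]
    rw [this]
    exact (convex_closedBall _ _).linear_preimage _
  refine convexHull_min ?_ hconv hV
  rintro W ⟨u, hu, hux, huW⟩
  have hux' : Tendsto (fun k => u k - x) atTop (𝓝 h) := by
    simpa using hux.sub_const x
  refine le_of_tendsto_of_tendsto (b := atTop)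
    (f := fun k => ‖f (u k) - f x - fderiv ℝ f (u k) (u k - x)‖)
    (g := fun k => C * ‖u k - x‖ ^ 2) ?_ ?_ ?_
  · have happ := ((isBoundedBilinearMap_apply (𝕜 := ℝ)).continuous.tendsto (W, h)).comp
      (Tendsto.prodMk_nhds huW hux')
    exact ((((hf.tendsto _).comp hux).sub_const _).sub happ).norm
  · exact (hux'.norm.pow 2).const_mul C
  · filter_upwards [hux'.norm.eventually (gt_mem_nhds hh)] with k hk
    have := hC (u k - x) hk
    rw [add_sub_cancel] at this
    exact this (hu k)

/-- Second-order Taylor estimate, uniform in both points near `x₀`. -/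
theorem exists_taylor_bound {f : E → F} {x₀ : E} (hf : ContDiffAt ℝ 2 f x₀) :
    ∃ C : ℝ, 0 ≤ C ∧ ∃ δ > 0, (∀ x ∈ Metric.ball x₀ δ, DifferentiableAt ℝ f x) ∧
      ∀ x ∈ Metric.ball x₀ δ, ∀ y ∈ Metric.ball x₀ δ,
        ‖f y - f x - fderiv ℝ f x (y - x)‖ ≤ C * ‖y - x‖ ^ 2 := by
  have h1 : ContDiffAt ℝ 1 (fderiv ℝ f) x₀ := hf.fderiv_right (by norm_num)
  obtain ⟨K, t, ht, hK⟩ := h1.exists_lipschitzOnWith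
  have h2 : ∀ᶠ x in 𝓝 x₀, DifferentiableAt ℝ f x := by
    filter_upwards [hf.eventually (by simp)] with x hx
    exact hx.differentiableAt (by simp)
  obtain ⟨δ, hδ, hball⟩ := Metric.mem_nhds_iff.1 (inter_mem ht h2)
  refine ⟨K, K.2, δ, hδ, fun x hx => (hball hx).2, fun x hx y hy => ?_⟩
  have hseg : segment ℝ x y ⊆ Metric.ball x₀ δ := (convex_ball x₀ δ).segment_subset hx hy
  have := (convex_segment x y).norm_image_sub_le_of_norm_hasFDerivWithin_le' (𝕜 := ℝ)
    (f := f) (f' := fderiv ℝ f) (φ := fderiv ℝ f x) (C := K * ‖y - x‖)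
    (fun z hz => (hball (hseg hz)).2.hasFDerivAt.hasFDerivWithinAt) ?_
    (left_mem_segment ℝ x y) (right_mem_segment ℝ x y)
  · rw [pow_two, ← mul_assoc]
    exact this
  · intro z hz
    have h3 := hK.dist_le_mul z (hball (hseg hz)).1 x (hball hx).1
    rw [dist_eq_norm, dist_eq_norm] at h3
    refine h3.trans (mul_le_mul_of_nonneg_left ?_ K.2)
    simpa [norm_sub_rev] using norm_sub_le_of_mem_segment hz

section LocalModel

variable {G G' : Type*} [NormedAddCommGroup G] [NormedSpace ℝ G]
  [NormedAddCommGroup G'] [NormedSpace ℝ G']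

/-- If `N` is affine along the ray `t ↦ b x + t η`, then difference quotients of
`y ↦ R (y, N (b y))` differ from those of a smooth map only by the distance between `η` and the
difference quotient of `b`. -/
theorem eventually_norm_quotient_sub_le {R : E × G → F} {b : E → G'} {N : G' → G} {KN L : NNReal}
    (hN : LipschitzWith KN N) {x d : E} {η : G'} {ν : G} {s : Set (E × G)}
    (hR : LipschitzOnWith L R s) (hs : s ∈ 𝓝 (x, N (b x))) (hb : ContinuousAt b x)
    (hη : ∀ t : ℝ, 0 ≤ t → N (b x + t • η) = N (b x) + t • ν) :
    ∀ᶠ t in 𝓝[>] (0 : ℝ),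
      ‖t⁻¹ • (R (x + t • d, N (b (x + t • d))) - R (x, N (b x))) -
        t⁻¹ • (R (x + t • d, N (b x) + t • ν) - R (x, N (b x)))‖ ≤
      L * (KN * ‖t⁻¹ • (b (x + t • d) - b x) - η‖) := by
  have hline : Tendsto (fun t : ℝ => x + t • d) (𝓝[>] 0) (𝓝 x) := by
    have : ContinuousAt (fun t : ℝ => x + t • d) 0 := by fun_prop
    simpa using this.tendsto.mono_left nhdsWithin_le_nhds
  have h1 : Tendsto (fun t : ℝ => (x + t • d, N (b (x + t • d)))) (𝓝[>] 0)
      (𝓝 (x, N (b x))) :=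
    hline.prodMk_nhds
      ((hN.continuous.tendsto _).comp (hb.tendsto.comp hline))
  have h2 : Tendsto (fun t : ℝ => (x + t • d, N (b x) + t • ν)) (𝓝[>] 0) (𝓝 (x, N (b x))) := by
    have : ContinuousAt (fun t : ℝ => (x + t • d, N (b x) + t • ν)) 0 := by fun_prop
    simpa using this.tendsto.mono_left nhdsWithin_le_nhds
  filter_upwards [h1 hs, h2 hs, self_mem_nhdsWithin] with t ht1 ht2 (ht : 0 < t)
  have h3 := hR.dist_le_mul (x + t • d, N (b (x + t • d))) ht1 (x + t • d, N (b x) + t • ν) ht2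
  rw [← hη t ht.le, Prod.dist_eq, dist_self, max_eq_right dist_nonneg, dist_eq_norm] at h3
  have h4 := hN.dist_le_mul (b (x + t • d)) (b x + t • η)
  rw [dist_eq_norm] at h4
  have h5 : ‖R (x + t • d, N (b (x + t • d))) - R (x + t • d, N (b x + t • η))‖ ≤
      L * (KN * ‖b (x + t • d) - (b x + t • η)‖) := by
    rw [dist_eq_norm] at h3
    refine h3.trans (mul_le_mul_of_nonneg_left ?_ L.2)
    rwa [dist_eq_norm] at h4
  rw [← smul_sub, sub_sub_sub_cancel_right, ← hη t ht.le, norm_smul, norm_inv,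
    Real.norm_of_nonneg ht.le]
  have h6 : b (x + t • d) - (b x + t • η) = t • (t⁻¹ • (b (x + t • d) - b x) - η) := by
    rw [smul_sub, smul_inv_smul₀ ht.ne']
    abel
  rw [h6, norm_smul, Real.norm_of_nonneg ht.le] at h5
  calc t⁻¹ * _ ≤ t⁻¹ * (L * (KN * (t * ‖t⁻¹ • (b (x + t • d) - b x) - η‖))) := by gcongr
    _ = _ := by field_simp

theorem tendsto_quotient {f : E → F} {f' : E →L[ℝ] F} {x : E} (hf : HasFDerivAt f f' x) (d : E) :
    Tendsto (fun t : ℝ => t⁻¹ • (f (x + t • d) - f x)) (𝓝[>] 0) (𝓝 (f' d)) := by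
  simpa using HasDerivAt.tendsto_slope_zero_right (hf.hasLineDerivAt d)

theorem tendsto_quotient_prod {R : E × G → F} {x : E} {n : G} (hR : DifferentiableAt ℝ R (x, n))
    (d : E) (ν : G) :
    Tendsto (fun t : ℝ => t⁻¹ • (R (x + t • d, n + t • ν) - R (x, n))) (𝓝[>] 0)
      (𝓝 (fderiv ℝ R (x, n) (d, ν))) :=
  tendsto_quotient hR.hasFDerivAt (d, ν)

/-- At `x₀`, where `b` vanishes, `N` is affine along every ray by homogeneity. -/
theorem directionallyDifferentiableAt_of_model {P : E → F} {x₀ : E} {R : E × G → F} {b : E → G'}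
    {N : G' → G} {KN : NNReal} (hN : LipschitzWith KN N)
    (hN' : ∀ t : ℝ, 0 ≤ t → ∀ y, N (t • y) = t • N y)
    (hP : ∀ᶠ x in 𝓝 x₀, P x = R (x, N (b x)))
    (hR : ContDiffAt ℝ 2 R (x₀, 0)) (hb : DifferentiableAt ℝ b x₀) (hb0 : b x₀ = 0) :
    DirectionallyDifferentiableAt P x₀ := by
  intro d
  have hN0 : N 0 = 0 := by simpa using hN' 0 le_rfl 0
  have hn : N (b x₀) = 0 := by rw [hb0, hN0]
  obtain ⟨L, s, hs, hL⟩ := (hR.of_le (by norm_num : (1 : WithTop ℕ∞) ≤ 2)).exists_lipschitzOnWith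
  set η := fderiv ℝ b x₀ d
  have h1 := eventually_norm_quotient_sub_le (d := d) (η := η) (ν := N η) hN hL
    (by rwa [hn]) hb.continuousAt (fun t ht => by rw [hb0, zero_add, hN' t ht, hN0, zero_add])
  have h2 := tendsto_quotient_prod (hR.differentiableAt (by simp)) d (N η)
  have h3 : Tendsto (fun t : ℝ => (L : ℝ) * (KN * ‖t⁻¹ • (b (x₀ + t • d) - b x₀) - η‖))
      (𝓝[>] 0) (𝓝 0) := by
    have := (((tendsto_quotient hb.hasFDerivAt d).sub_const η).norm.const_mul (KN : ℝ)).const_mul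
      (L : ℝ)
    simpa [η] using this
  refine ⟨fderiv ℝ R (x₀, 0) (d, N η), ?_⟩
  have h4 := squeeze_zero_norm' h1 h3
  have h5 := h4.add (hn ▸ h2)
  rw [zero_add] at h5
  have hline : Tendsto (fun t : ℝ => x₀ + t • d) (𝓝[>] 0) (𝓝 x₀) := by
    have : ContinuousAt (fun t : ℝ => x₀ + t • d) 0 := by fun_prop
    simpa using this.tendsto.mono_left nhdsWithin_le_nhds
  refine (hn ▸ h5).congr' ?_
  filter_upwards [hline.eventually hP] with t ht
  rw [ht, hP.self_of_nhds]
  simp [hn]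

/-- The second-order estimate for `x ↦ R (x, N (b x))` at points of differentiability.  By
homogeneity `N` is linear along the ray through `b x`, and up to `O(‖h‖²)` the map `b` moves along
that ray when `x = x₀ + h` moves in the direction `h`. -/
theorem exists_bound_of_model {P : E → F} {x₀ : E} {R : E × G → F} {b : E → G'}
    {N : G' → G} {KN : NNReal} (hN : LipschitzWith KN N)
    (hN' : ∀ t : ℝ, 0 ≤ t → ∀ y, N (t • y) = t • N y)
    (hP : ∀ᶠ x in 𝓝 x₀, P x = R (x, N (b x)))
    (hR : ContDiffAt ℝ 2 R (x₀, 0)) (hb : ContDiffAt ℝ 2 b x₀) (hb0 : b x₀ = 0) :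
    ∃ C : ℝ, ∃ δ > 0, ∀ h : E, ‖h‖ < δ → DifferentiableAt ℝ P (x₀ + h) →
      ‖P (x₀ + h) - P x₀ - fderiv ℝ P (x₀ + h) h‖ ≤ C * ‖h‖ ^ 2 := by
  have hN0 : N 0 = 0 := by simpa using hN' 0 le_rfl 0
  obtain ⟨L, s, hs, hL⟩ := (hR.of_le (by norm_num : (1 : WithTop ℕ∞) ≤ 2)).exists_lipschitzOnWith
  obtain ⟨Kb, sb, hsb, hKb⟩ :=
    (hb.of_le (by norm_num : (1 : WithTop ℕ∞) ≤ 2)).exists_lipschitzOnWith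
  obtain ⟨CR, hCR, δR, hδR, hRd, hRt⟩ := exists_taylor_bound hR
  obtain ⟨Cb, hCb, δb, hδb, hbd, hbt⟩ := exists_taylor_bound hb
  have hcont : ContinuousAt (fun x => (x, N (b x))) x₀ :=
    continuousAt_id.prodMk (hN.continuous.continuousAt.comp hb.continuousAt)
  have hnbr : Metric.ball (x₀, (0 : G)) δR ∩ interior s ∈ 𝓝 (x₀, N (b x₀)) := by
    rw [hb0, hN0]
    exact inter_mem (Metric.ball_mem_nhds _ hδR) (interior_mem_nhds.2 hs)
  have hev : ∀ᶠ x in 𝓝 x₀, (∀ᶠ y in 𝓝 x, P y = R (y, N (b y))) ∧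
      (x, N (b x)) ∈ Metric.ball (x₀, (0 : G)) δR ∩ interior s ∧ x ∈ Metric.ball x₀ δb ∧ x ∈ sb :=
    hP.eventually_nhds.and ((hcont.eventually hnbr).and
      ((Metric.isOpen_ball.eventually_mem (Metric.mem_ball_self hδb)).and hsb))
  obtain ⟨δ, hδ, hball⟩ := Metric.eventually_nhds_iff_ball.1 hev
  refine ⟨CR * (1 + KN * Kb) ^ 2 + L * (KN * Cb), δ, hδ, fun h hh hd => ?_⟩
  obtain ⟨hPx, ⟨hx1, hx2⟩, hx3, hx4⟩ := hball (x₀ + h) (by simpa using hh)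
  set x := x₀ + h with hx
  have hx0 : x - x₀ = h := by simp [hx]
  set β := b x with hβ
  set n := N β with hn
  have hbn : ‖β‖ ≤ Kb * ‖h‖ := by
    have := hKb.dist_le_mul x hx4 x₀ (mem_of_mem_nhds hsb)
    rwa [dist_eq_norm, dist_eq_norm, hb0, sub_zero, hx0] at this
  have hnn : ‖n‖ ≤ KN * Kb * ‖h‖ := by
    have := hN.dist_le_mul β 0
    rw [dist_eq_norm, dist_eq_norm, hN0, sub_zero, sub_zero] at this
    rw [mul_assoc]
    exact this.trans (mul_le_mul_of_nonneg_left hbn KN.2)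
  have hbx : DifferentiableAt ℝ b x := hbd x hx3
  -- The derivative of `b` in the direction `h = x - x₀` is `b x` up to second order.
  have hβ' : ‖fderiv ℝ b x h - β‖ ≤ Cb * ‖h‖ ^ 2 := by
    have := hbt x hx3 x₀ (Metric.mem_ball_self hδb)
    rw [hb0, ← neg_sub x x₀, hx0, map_neg, norm_neg, zero_sub, sub_neg_eq_add, neg_add_eq_sub]
      at this
    exact this
  have hray : ∀ t : ℝ, 0 ≤ t → N (b x + t • β) = N (b x) + t • n := by
    intro t ht
    have h1 : b x + t • β = (1 + t) • β := by rw [add_smul, one_smul]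
    rw [h1, hN' _ (by positivity), add_smul, one_smul]
  have h1 := eventually_norm_quotient_sub_le (d := h) hN hL (mem_interior_iff_mem_nhds.1 hx2)
    hbx.continuousAt hray
  have h2 := tendsto_quotient_prod (hRd _ hx1) h n
  have h3 := tendsto_quotient hd.hasFDerivAt h
  have hline : Tendsto (fun t : ℝ => x + t • h) (𝓝[>] 0) (𝓝 x) := by
    have : ContinuousAt (fun t : ℝ => x + t • h) 0 := by fun_prop
    simpa using this.tendsto.mono_left nhdsWithin_le_nhds
  have h4 : Tendsto (fun t : ℝ => t⁻¹ • (R (x + t • h, N (b (x + t • h))) - R (x, N (b x))))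
      (𝓝[>] 0) (𝓝 (fderiv ℝ P x h)) := by
    refine h3.congr' ?_
    filter_upwards [hline.eventually hPx] with t ht
    rw [ht, hPx.self_of_nhds]
  have h5 := ((((tendsto_quotient hbx.hasFDerivAt h).sub_const β).norm.const_mul
    (KN : ℝ)).const_mul (L : ℝ))
  -- In the limit, the derivative of `P` at `x` in the direction `h` is compared with that of `R`.
  have h6 := le_of_tendsto_of_tendsto (h4.sub h2).norm h5 h1
  have h7 := hRt _ hx1 _ (Metric.mem_ball_self hδR)
  have hpair : ((x₀, 0) : E × G) - (x, N (b x)) = -(h, n) := by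
    rw [← hx0]; ext <;> simp [hn, hβ]
  rw [hpair, map_neg, norm_neg] at h7
  have hP0 : P x₀ = R (x₀, 0) := by rw [hP.self_of_nhds, hb0, hN0]
  have hpn : ‖(h, n)‖ ≤ (1 + KN * Kb) * ‖h‖ := by
    have h0 : 0 ≤ (KN * Kb : ℝ) * ‖h‖ := by positivity
    refine max_le ?_ ?_
    · simp only; nlinarith [norm_nonneg h]
    · refine hnn.trans ?_; nlinarith [norm_nonneg h]
  calc ‖P x - P x₀ - fderiv ℝ P x h‖
      = ‖-(R (x₀, 0) - R (x, N (b x)) - -fderiv ℝ R (x, N (b x)) (h, n)) -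
          (fderiv ℝ P x h - fderiv ℝ R (x, N (b x)) (h, n))‖ := by
        rw [hPx.self_of_nhds, hP0]; congr 1; abel
    _ ≤ CR * ‖(h, n)‖ ^ 2 + L * (KN * ‖fderiv ℝ b x h - β‖) :=
        (norm_sub_le _ _).trans (add_le_add (by rw [norm_neg]; exact h7) h6)
    _ ≤ CR * ((1 + KN * Kb) * ‖h‖) ^ 2 + L * (KN * (Cb * ‖h‖ ^ 2)) := by gcongr
    _ = _ := by ring

theorem stronglySemismoothAt_of_model {P : E → F} (hPc : Continuous P) {x₀ : E} {R : E × G → F}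
    {b : E → G'} {N : G' → G} {KN : NNReal} (hN : LipschitzWith KN N)
    (hN' : ∀ t : ℝ, 0 ≤ t → ∀ y, N (t • y) = t • N y)
    (hP : ∀ᶠ x in 𝓝 x₀, P x = R (x, N (b x)))
    (hR : ContDiffAt ℝ 2 R (x₀, 0)) (hb : ContDiffAt ℝ 2 b x₀) (hb0 : b x₀ = 0) :
    StronglySemismoothAt P (clarkeJacobian P) x₀ := by
  refine ⟨directionallyDifferentiableAt_of_model hN hN' hP hR (hb.differentiableAt (by simp)) hb0,
    ?_⟩
  obtain ⟨C, δ, hδ, hC⟩ := exists_bound_of_model hN hN' hP hR hb hb0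
  exact ⟨C, δ, hδ, norm_sub_le_of_mem_clarkeJacobian hPc hC⟩

end LocalModel

end Nonsmooth

/-! ### The Frobenius inner product and singular value decompositions -/

section Matrices

variable {m q n : ℕ}

/-- The Frobenius inner product `tr (Aᵀ B)`. -/
def frobInner (A B : Matrix (Fin m) (Fin q) ℝ) : ℝ := (Aᵀ * B).trace

theorem frobInner_eq_sum (A B : Matrix (Fin m) (Fin q) ℝ) :
    frobInner A B = ∑ i, ∑ j, A i j * B i j := by
  rw [Finset.sum_comm]
  simp [frobInner, Matrix.trace, Matrix.mul_apply]

theorem norm_sq_eq_frobInner (A : Matrix (Fin m) (Fin q) ℝ) : ‖A‖ ^ 2 = frobInner A A := by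
  rw [frobInner_eq_sum, Matrix.frobenius_norm_def, ← Real.sqrt_eq_rpow, Real.sq_sqrt]
  · simp [← pow_two]
  · positivity

theorem frobInner_comm (A B : Matrix (Fin m) (Fin q) ℝ) : frobInner A B = frobInner B A := by
  simp only [frobInner_eq_sum, mul_comm]

theorem frobInner_add_left (A B C : Matrix (Fin m) (Fin q) ℝ) :
    frobInner (A + B) C = frobInner A C + frobInner B C := by
  simp [frobInner, Matrix.add_mul]

theorem frobInner_sub_left (A B C : Matrix (Fin m) (Fin q) ℝ) :
    frobInner (A - B) C = frobInner A C - frobInner B C := by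
  simp [frobInner, Matrix.sub_mul]

theorem frobInner_smul_left (r : ℝ) (A C : Matrix (Fin m) (Fin q) ℝ) :
    frobInner (r • A) C = r * frobInner A C := by
  simp [frobInner]

theorem frobInner_sub_right (A B C : Matrix (Fin m) (Fin q) ℝ) :
    frobInner A (B - C) = frobInner A B - frobInner A C := by
  simp [frobInner, Matrix.mul_sub]

theorem norm_sub_sq_eq_frobInner (A B : Matrix (Fin m) (Fin q) ℝ) :
    ‖A - B‖ ^ 2 = ‖A‖ ^ 2 - 2 * frobInner A B + ‖B‖ ^ 2 := by
  rw [norm_sq_eq_frobInner, norm_sq_eq_frobInner, norm_sq_eq_frobInner, frobInner_sub_left,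
    frobInner_sub_right, frobInner_sub_right, frobInner_comm B A]
  ring

/-- The Cauchy-Schwarz inequality, from the discriminant of `t ↦ ‖t A - B‖²`. -/
theorem frobInner_le_norm_mul_norm (A B : Matrix (Fin m) (Fin q) ℝ) :
    frobInner A B ≤ ‖A‖ * ‖B‖ := by
  have h : ∀ t : ℝ, 0 ≤ ‖A‖ ^ 2 * (t * t) + (-2 * frobInner A B) * t + ‖B‖ ^ 2 := by
    intro t
    have h1 : 0 ≤ ‖t • A - B‖ ^ 2 := sq_nonneg _
    rw [norm_sub_sq_eq_frobInner, frobInner_smul_left, norm_smul, mul_pow, Real.norm_eq_abs,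
      sq_abs] at h1
    linarith
  have h2 := discrim_le_zero h
  rw [discrim] at h2
  exact abs_le_of_sq_le_sq' (by nlinarith) (by positivity) |>.2

theorem transpose_mul_self_of_mem {U : Matrix (Fin n) (Fin n) ℝ}
    (hU : U ∈ Matrix.orthogonalGroup (Fin n) ℝ) : Uᵀ * U = 1 :=
  (Matrix.mem_orthogonalGroup_iff' _ _).1 hU

theorem mul_transpose_self_of_mem {U : Matrix (Fin n) (Fin n) ℝ}
    (hU : U ∈ Matrix.orthogonalGroup (Fin n) ℝ) : U * Uᵀ = 1 :=
  (Matrix.mem_orthogonalGroup_iff _ _).1 hU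

theorem transpose_mem_orthogonalGroup {U : Matrix (Fin n) (Fin n) ℝ}
    (hU : U ∈ Matrix.orthogonalGroup (Fin n) ℝ) : Uᵀ ∈ Matrix.orthogonalGroup (Fin n) ℝ := by
  rw [Matrix.mem_orthogonalGroup_iff, Matrix.transpose_transpose]
  exact transpose_mul_self_of_mem hU

theorem frobInner_conj {U : Matrix (Fin m) (Fin m) ℝ} (hU : U ∈ Matrix.orthogonalGroup (Fin m) ℝ)
    {V : Matrix (Fin q) (Fin q) ℝ} (hV : V ∈ Matrix.orthogonalGroup (Fin q) ℝ)
    (A B : Matrix (Fin m) (Fin q) ℝ) :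
    frobInner (U * A * Vᵀ) (U * B * Vᵀ) = frobInner A B := by
  have h : (U * A * Vᵀ)ᵀ * (U * B * Vᵀ) = V * ((Aᵀ * B) * Vᵀ) := by
    simp only [Matrix.transpose_mul, Matrix.transpose_transpose, Matrix.mul_assoc]
    rw [← Matrix.mul_assoc Uᵀ U, transpose_mul_self_of_mem hU, Matrix.one_mul]
  rw [frobInner, h, Matrix.trace_mul_comm, Matrix.mul_assoc, transpose_mul_self_of_mem hV,
    Matrix.mul_one, frobInner]

/-- The `m × q` matrix `[1 0]`. -/
def idZero (m q : ℕ) : Matrix (Fin m) (Fin q) ℝ := diagZero q fun _ => 1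

theorem diagZero_eq (s : Fin m → ℝ) :
    diagZero q s = Matrix.diagonal s * idZero m q := by
  ext i j
  rw [Matrix.diagonal_mul]
  simp [diagZero, idZero]

theorem diagZero_mulVec (hmq : m ≤ q) (s : Fin m → ℝ) (w : Fin q → ℝ) (i : Fin m) :
    (diagZero q s *ᵥ w) i = s i * w (Fin.castLE hmq i) := by
  simp only [diagZero, Matrix.mulVec, dotProduct, Matrix.of_apply]
  rw [Finset.sum_eq_single (Fin.castLE hmq i)]
  · simp
  · intro j _ hj
    rw [if_neg, zero_mul]
    exact fun h => hj (Fin.ext h.symm)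
  · simp

theorem mul_diagZero_apply (hmq : m ≤ q) (A : Matrix (Fin n) (Fin m) ℝ) (s : Fin m → ℝ)
    (i : Fin n) (j : Fin m) :
    (A * diagZero q s) i (Fin.castLE hmq j) = A i j * s j := by
  rw [Matrix.mul_apply, Finset.sum_eq_single j]
  · simp [diagZero]
  · intro k _ hk
    have : (k : ℕ) ≠ j := fun h => hk (Fin.ext h)
    simp [diagZero, this]
  · simp

theorem mul_diagZero_apply_of_le (A : Matrix (Fin n) (Fin m) ℝ) (s : Fin m → ℝ)
    (i : Fin n) {j : Fin q} (hj : m ≤ j) : (A * diagZero q s) i j = 0 := by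
  rw [Matrix.mul_apply]
  refine Finset.sum_eq_zero fun k _ => ?_
  have : (k : ℕ) ≠ j := by omega
  simp [diagZero, this]

theorem diagZero_mul_apply (hmq : m ≤ q) (s : Fin m → ℝ) (A : Matrix (Fin q) (Fin n) ℝ)
    (i : Fin m) (j : Fin n) :
    (diagZero q s * A) i j = s i * A (Fin.castLE hmq i) j := by
  rw [Matrix.mul_apply, Finset.sum_eq_single (Fin.castLE hmq i)]
  · simp [diagZero]
  · intro k _ hk
    have : (i : ℕ) ≠ k := fun h => hk (Fin.ext h.symm)
    simp [diagZero, this]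
  · simp

theorem idZero_mul_transpose (hmq : m ≤ q) : idZero m q * (idZero m q)ᵀ = 1 := by
  ext i j
  rw [idZero, diagZero_mul_apply hmq, Matrix.transpose_apply, one_mul]
  simp [diagZero, Matrix.one_apply, Fin.ext_iff, eq_comm]

/-- The singular values of `U [Diag σ 0] Vᵀ` are read off from the characteristic polynomial of
`XᵀX`, which is that of a diagonal matrix. -/
theorem nuclearNorm_of_svd (hmq : m ≤ q) {U : Matrix (Fin m) (Fin m) ℝ}
    (hU : U ∈ Matrix.orthogonalGroup (Fin m) ℝ) {V : Matrix (Fin q) (Fin q) ℝ}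
    (hV : V ∈ Matrix.orthogonalGroup (Fin q) ℝ) {σ : Fin m → ℝ} (hσ : ∀ i, 0 ≤ σ i) :
    nuclearNorm (U * diagZero q σ * Vᵀ) = ∑ i, σ i := by
  set X := U * diagZero q σ * Vᵀ with hX
  set T := Matrix.toEuclideanLin X with hT
  set d : Fin q → ℝ := fun j => if h : (j : ℕ) < m then σ ⟨j, h⟩ ^ 2 else 0 with hd
  have hfin : Module.finrank ℝ (EuclideanSpace ℝ (Fin q)) = q := by simp
  have hchar : (T.adjoint ∘ₗ T).charpoly = ∏ j, (Polynomial.X - Polynomial.C (d j)) := by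
    have h1 : T.adjoint ∘ₗ T = Matrix.toLin (EuclideanSpace.basisFun (Fin q) ℝ).toBasis
        (EuclideanSpace.basisFun (Fin q) ℝ).toBasis (Xᵀ * X) := by
      rw [hT, ← Matrix.toEuclideanLin_conjTranspose_eq_adjoint,
        Matrix.toEuclideanLin_eq_toLin_orthonormal, Matrix.toEuclideanLin_eq_toLin_orthonormal,
        ← Matrix.toLin_mul, Matrix.conjTranspose_eq_transpose_of_trivial]
    have h2 : Xᵀ * X = V * (Matrix.diagonal d * Vᵀ) := by
      have h3 : (diagZero q σ)ᵀ * diagZero q σ = Matrix.diagonal d := by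
        ext i j
        rw [Matrix.mul_apply, Matrix.diagonal_apply]
        by_cases hi : (i : ℕ) < m
        · rw [Finset.sum_eq_single ⟨i, hi⟩]
          · by_cases hij : i = j
            · simp [diagZero, hij, hd, pow_two]
              subst hij
              simp [hi]
            · have : (i : ℕ) ≠ j := fun h => hij (Fin.ext h)
              simp [diagZero, hij, this]
          · intro k _ hk
            have : (k : ℕ) ≠ i := fun h => hk (Fin.ext h)
            simp [diagZero, this]
          · simp
        · rw [Finset.sum_eq_zero]
          · simp [hd, hi]
          · intro k _
            have : (k : ℕ) ≠ i := by omega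
            simp [diagZero, this]
      rw [hX, ← h3]
      simp only [Matrix.transpose_mul, Matrix.transpose_transpose, Matrix.mul_assoc]
      rw [← Matrix.mul_assoc Uᵀ U, transpose_mul_self_of_mem hU, Matrix.one_mul]
    rw [h1, Matrix.charpoly_toLin, h2, Matrix.charpoly_mul_comm, Matrix.mul_assoc,
      transpose_mul_self_of_mem hV, Matrix.mul_one, Matrix.charpoly_diagonal]
  have hroots : (Finset.univ.val.map (T.isSymmetric_adjoint_comp_self.eigenvalues hfin)) =
      Finset.univ.val.map d := by
    have h1 := T.isSymmetric_adjoint_comp_self.roots_charpoly_eq_eigenvalues hfin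
    rw [hchar, Polynomial.roots_prod _ _
      (Finset.prod_ne_zero_iff.2 fun j _ => Polynomial.X_sub_C_ne_zero _)] at h1
    simp only [Polynomial.roots_X_sub_C, Multiset.bind_singleton] at h1
    exact h1.symm
  have hsum : nuclearNorm X = ∑ j, √(d j) := by
    rw [nuclearNorm, Finsupp.sum_of_support_subset (s := Finset.range q) _ _ _ (by simp),
      Finset.sum_range]
    · simp only [LinearMap.singularValues_fin _ hfin]
      have := congrArg (fun s : Multiset ℝ => (s.map Real.sqrt).sum) hroots
      rw [Multiset.map_map, Multiset.map_map] at this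
      exact this
    · intro i hi
      rw [Finset.mem_range]
      by_contra hq
      exact Finsupp.mem_support_iff.1 hi
        (LinearMap.singularValues_of_finrank_le _ (by rw [hfin]; omega))
  rw [hsum]
  obtain ⟨k, rfl⟩ := Nat.exists_eq_add_of_le hmq
  rw [Fin.sum_univ_add]
  simp [hd, Real.sqrt_sq, hσ]

/-- Real symmetric matrices are orthogonally diagonalizable. -/
theorem exists_orthogonal_diagonal {S : Matrix (Fin m) (Fin m) ℝ} (hS : Sᵀ = S) :
    ∃ U ∈ Matrix.orthogonalGroup (Fin m) ℝ, ∃ d : Fin m → ℝ,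
      S = U * Matrix.diagonal d * Uᵀ := by
  have hH : S.IsHermitian := by
    rw [Matrix.IsHermitian, Matrix.conjTranspose_eq_transpose_of_trivial, hS]
  refine ⟨hH.eigenvectorUnitary, hH.eigenvectorUnitary.2, hH.eigenvalues, ?_⟩
  have := hH.spectral_theorem
  rw [Unitary.conjStarAlgAut_apply] at this
  exact this

/-- Singular value decomposition: diagonalize `X Xᵀ = U D Uᵀ`; the nonzero rows of `UᵀX` are
orthogonal and, once normalized, extend to an orthonormal basis. -/
theorem exists_svd (hmq : m ≤ q) (X : Matrix (Fin m) (Fin q) ℝ) :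
    ∃ U ∈ Matrix.orthogonalGroup (Fin m) ℝ, ∃ V ∈ Matrix.orthogonalGroup (Fin q) ℝ,
      ∃ σ : Fin m → ℝ, (∀ i, 0 ≤ σ i) ∧ X = U * diagZero q σ * Vᵀ := by
  obtain ⟨U, hU, d, hd⟩ := exists_orthogonal_diagonal (S := X * Xᵀ) (by simp)
  set W := Uᵀ * X with hW
  have hWW : W * Wᵀ = Matrix.diagonal d := by
    rw [hW, Matrix.transpose_mul, Matrix.transpose_transpose, Matrix.mul_assoc,
      ← Matrix.mul_assoc X, hd]
    simp only [Matrix.mul_assoc]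
    rw [transpose_mul_self_of_mem hU, Matrix.mul_one, ← Matrix.mul_assoc,
      transpose_mul_self_of_mem hU, Matrix.one_mul]
  have hrow : ∀ i j, W i ⬝ᵥ W j = if i = j then d i else 0 := by
    intro i j
    have := congrFun (congrFun hWW i) j
    rw [Matrix.diagonal_apply] at this
    rw [← this]
    rfl
  have hd0 : ∀ i, 0 ≤ d i := by
    intro i
    have := hrow i i
    rw [if_pos rfl] at this
    rw [← this]
    exact Finset.sum_nonneg fun _ _ => mul_self_nonneg _
  -- The normalized rows with nonzero norm are orthonormal; the other columns of `V` are arbitrary.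
  set s : Set (Fin q) := {j | ∃ h : (j : ℕ) < m, d ⟨j, h⟩ ≠ 0} with hs
  set v : Fin q → EuclideanSpace ℝ (Fin q) := fun j =>
    if h : (j : ℕ) < m then (√(d ⟨j, h⟩))⁻¹ • WithLp.toLp 2 (W ⟨j, h⟩) else 0 with hv
  have hon : Orthonormal ℝ (s.domRestrict v) := by
    rw [orthonormal_iff_ite]
    rintro ⟨i, hi, hi'⟩ ⟨j, hj, hj'⟩
    have h1 : inner ℝ (WithLp.toLp 2 (W ⟨i, hi⟩) : EuclideanSpace ℝ (Fin q))
        (WithLp.toLp 2 (W ⟨j, hj⟩)) = W ⟨j, hj⟩ ⬝ᵥ W ⟨i, hi⟩ := by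
      simp [EuclideanSpace.inner_eq_star_dotProduct]
    simp only [Set.domRestrict_apply, hv, hi, hj, dif_pos, inner_smul_left, inner_smul_right, h1,
      hrow]
    by_cases hij : i = j
    · subst hij
      have h2 : √(d ⟨i, hi⟩) ≠ 0 := by
        rw [Real.sqrt_ne_zero']
        exact lt_of_le_of_ne (hd0 _) hi'.symm
      have h3 : d ⟨i, hi⟩ = √(d ⟨i, hi⟩) * √(d ⟨i, hi⟩) := (Real.mul_self_sqrt (hd0 _)).symm
      simp only [if_true, conj_trivial]
      nth_rewrite 3 [h3]
      field_simp
    · have h4 : ¬ (j = i) := fun h => hij h.symm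
      have h5 : (j : ℕ) ≠ i := fun h => h4 (Fin.ext h)
      simp [hij, h5]
  obtain ⟨b, hb⟩ := hon.exists_orthonormalBasis_extension_of_card_eq (by simp)
  set V : Matrix (Fin q) (Fin q) ℝ := Matrix.of fun i j => b j i with hVdef
  have hV : V ∈ Matrix.orthogonalGroup (Fin q) ℝ := by
    rw [Matrix.mem_orthogonalGroup_iff']
    ext i j
    have h1 := (orthonormal_iff_ite.1 b.orthonormal) i j
    rw [EuclideanSpace.inner_eq_star_dotProduct] at h1
    rw [Matrix.one_apply, ← h1, Matrix.mul_apply, dotProduct]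
    simp [hVdef, mul_comm]
  refine ⟨U, hU, V, hV, fun i => √(d i), fun i => Real.sqrt_nonneg _, ?_⟩
  have hWV : W = diagZero q (fun i => √(d i)) * Vᵀ := by
    ext i c
    rw [diagZero_mul_apply hmq]
    by_cases hi : d i = 0
    · have h1 : W i = 0 := by
        have := hrow i i
        rw [if_pos rfl, hi] at this
        exact dotProduct_self_eq_zero.1 this
      simp [hi, h1]
    · have h1 : b (Fin.castLE hmq i) = v (Fin.castLE hmq i) := hb _ ⟨i.2, hi⟩
      have h2 : √(d i) ≠ 0 := by
        rw [Real.sqrt_ne_zero']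
        exact lt_of_le_of_ne (hd0 _) (Ne.symm hi)
      simp [hVdef, h1, hv, h2]
  rw [Matrix.mul_assoc, ← hWV, hW, ← Matrix.mul_assoc, mul_transpose_self_of_mem hU,
    Matrix.one_mul]

theorem nuclearNorm_conj (hmq : m ≤ q) {U : Matrix (Fin m) (Fin m) ℝ}
    (hU : U ∈ Matrix.orthogonalGroup (Fin m) ℝ) {V : Matrix (Fin q) (Fin q) ℝ}
    (hV : V ∈ Matrix.orthogonalGroup (Fin q) ℝ) (X : Matrix (Fin m) (Fin q) ℝ) :
    nuclearNorm (U * X * Vᵀ) = nuclearNorm X := by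
  obtain ⟨A, hA, B, hB, σ, hσ, rfl⟩ := exists_svd hmq X
  have h : U * (A * diagZero q σ * Bᵀ) * Vᵀ = (U * A) * diagZero q σ * (V * B)ᵀ := by
    simp only [Matrix.transpose_mul, Matrix.mul_assoc]
  rw [h, nuclearNorm_of_svd hmq (mul_mem hU hA) (mul_mem hV hB) hσ,
    nuclearNorm_of_svd hmq hA hB hσ]

/-! ### Duality between the nuclear norm and contractions -/

/-- `G` has spectral norm at most one, expressed through its bilinear form. -/
def IsContraction (G : Matrix (Fin m) (Fin q) ℝ) : Prop :=
  ∀ v w, v ⬝ᵥ G *ᵥ w ≤ (v ⬝ᵥ v + w ⬝ᵥ w) / 2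

theorem dotProduct_mulVec_self_of_mem {U : Matrix (Fin n) (Fin n) ℝ}
    (hU : U ∈ Matrix.orthogonalGroup (Fin n) ℝ) (v : Fin n → ℝ) :
    (U *ᵥ v) ⬝ᵥ (U *ᵥ v) = v ⬝ᵥ v := by
  rw [Matrix.dotProduct_mulVec, ← Matrix.vecMul_transpose, Matrix.vecMul_vecMul,
    transpose_mul_self_of_mem hU, Matrix.vecMul_one]

theorem IsContraction.conj {G : Matrix (Fin m) (Fin q) ℝ} (hG : IsContraction G)
    {U : Matrix (Fin m) (Fin m) ℝ} (hU : U ∈ Matrix.orthogonalGroup (Fin m) ℝ)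
    {V : Matrix (Fin q) (Fin q) ℝ} (hV : V ∈ Matrix.orthogonalGroup (Fin q) ℝ) :
    IsContraction (U * G * Vᵀ) := by
  intro v w
  have h := hG (Uᵀ *ᵥ v) (Vᵀ *ᵥ w)
  rw [dotProduct_mulVec_self_of_mem (transpose_mem_orthogonalGroup hU),
    dotProduct_mulVec_self_of_mem (transpose_mem_orthogonalGroup hV)] at h
  rwa [← Matrix.mulVec_mulVec, ← Matrix.mulVec_mulVec, Matrix.dotProduct_mulVec,
    ← Matrix.mulVec_transpose]

theorem isContraction_diagZero (hmq : m ≤ q) {g : Fin m → ℝ} (hg : ∀ i, 0 ≤ g i ∧ g i ≤ 1) :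
    IsContraction (diagZero q g) := by
  intro v w
  have h1 : ∑ i, w (Fin.castLE hmq i) * w (Fin.castLE hmq i) ≤ w ⬝ᵥ w := by
    have := Finset.sum_map Finset.univ (Fin.castLEEmb hmq) fun j => w j * w j
    simp only [Fin.coe_castLEEmb] at this
    rw [← this]
    exact Finset.sum_le_sum_of_subset_of_nonneg (Finset.subset_univ _)
      fun _ _ _ => mul_self_nonneg _
  have h2 : v ⬝ᵥ diagZero q g *ᵥ w ≤
      ∑ i, (v i * v i + w (Fin.castLE hmq i) * w (Fin.castLE hmq i)) / 2 := by
    refine Finset.sum_le_sum fun i _ => ?_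
    rw [diagZero_mulVec hmq]
    obtain ⟨h3, h4⟩ := hg i
    set x := v i
    set y := w (Fin.castLE hmq i)
    nlinarith [mul_nonneg h3 (sq_nonneg (x - y)), mul_nonneg (sub_nonneg.2 h4) (sq_nonneg x),
      mul_nonneg (sub_nonneg.2 h4) (sq_nonneg y)]
  rw [← Finset.sum_div, Finset.sum_add_distrib] at h2
  have h3 : v ⬝ᵥ v = ∑ i, v i * v i := rfl
  rw [h3]
  linarith

theorem IsContraction.apply_le_one {G : Matrix (Fin m) (Fin q) ℝ} (hG : IsContraction G)
    (i : Fin m) (j : Fin q) : G i j ≤ 1 := by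
  have := hG (Pi.single i 1) (Pi.single j 1)
  simpa using this

theorem frobInner_diagZero (hmq : m ≤ q) (G : Matrix (Fin m) (Fin q) ℝ) (σ : Fin m → ℝ) :
    frobInner G (diagZero q σ) = ∑ i, G i (Fin.castLE hmq i) * σ i := by
  rw [frobInner_eq_sum]
  refine Finset.sum_congr rfl fun i _ => ?_
  rw [Finset.sum_eq_single (Fin.castLE hmq i)]
  · simp [diagZero]
  · intro j _ hj
    have : (i : ℕ) ≠ j := fun h => hj (Fin.ext h.symm)
    simp [diagZero, this]
  · simp

/-- A contraction is a subgradient of the nuclear norm at the origin: in singular bases of `Y`, the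
pairing only sees diagonal entries, and these are at most one. -/
theorem IsContraction.frobInner_le (hmq : m ≤ q) {G : Matrix (Fin m) (Fin q) ℝ}
    (hG : IsContraction G) (Y : Matrix (Fin m) (Fin q) ℝ) : frobInner G Y ≤ nuclearNorm Y := by
  obtain ⟨U, hU, V, hV, σ, hσ, rfl⟩ := exists_svd hmq Y
  have h1 : G = U * (Uᵀ * G * V) * Vᵀ := by
    rw [← Matrix.mul_assoc, ← Matrix.mul_assoc, mul_transpose_self_of_mem hU, Matrix.one_mul,
      Matrix.mul_assoc, mul_transpose_self_of_mem hV, Matrix.mul_one]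
  have h2 : IsContraction (Uᵀ * G * V) := by
    simpa using hG.conj (transpose_mem_orthogonalGroup hU) (transpose_mem_orthogonalGroup hV)
  rw [nuclearNorm_of_svd hmq hU hV hσ, h1, frobInner_conj hU hV, frobInner_diagZero hmq]
  exact Finset.sum_le_sum fun i _ =>
    mul_le_of_le_one_left (hσ i) (h2.apply_le_one _ _)

/-- Expansion of `tr (A S)` in an eigenbasis of `S`. -/
theorem trace_mul_conj_diagonal (A U : Matrix (Fin m) (Fin m) ℝ) (d : Fin m → ℝ) :
    (A * (U * Matrix.diagonal d * Uᵀ)).trace = ∑ i, (Uᵀ i ⬝ᵥ A *ᵥ Uᵀ i) * d i := by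
  rw [← Matrix.mul_assoc, ← Matrix.trace_mul_comm, ← Matrix.mul_assoc, ← Matrix.mul_assoc,
    Matrix.trace]
  refine Finset.sum_congr rfl fun i _ => ?_
  rw [Matrix.diag_apply, Matrix.mul_diagonal, Matrix.mul_assoc, Matrix.mul_apply]
  rfl

theorem PosSemidef.dotProduct_nonneg {S : Matrix (Fin m) (Fin m) ℝ} (hS : S.PosSemidef)
    (v : Fin m → ℝ) : 0 ≤ v ⬝ᵥ S *ᵥ v := by
  simpa using hS.dotProduct_mulVec_nonneg v

theorem PosSemidef.transpose_eq {S : Matrix (Fin m) (Fin m) ℝ} (hS : S.PosSemidef) : Sᵀ = S := by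
  rw [← Matrix.conjTranspose_eq_transpose_of_trivial]
  exact hS.1

theorem posSemidef_of_dotProduct_nonneg {S : Matrix (Fin m) (Fin m) ℝ} (hS : Sᵀ = S)
    (h : ∀ v, 0 ≤ v ⬝ᵥ S *ᵥ v) : S.PosSemidef := by
  refine Matrix.PosSemidef.of_dotProduct_mulVec_nonneg ?_ (by simpa using h)
  rw [Matrix.IsHermitian, Matrix.conjTranspose_eq_transpose_of_trivial, hS]

theorem PosSemidef.exists_diagonal {S : Matrix (Fin m) (Fin m) ℝ} (hS : S.PosSemidef) :
    ∃ U ∈ Matrix.orthogonalGroup (Fin m) ℝ, ∃ d : Fin m → ℝ, (∀ i, 0 ≤ d i) ∧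
      S = U * Matrix.diagonal d * Uᵀ := by
  obtain ⟨U, hU, d, rfl⟩ := exists_orthogonal_diagonal (PosSemidef.transpose_eq hS)
  refine ⟨U, hU, d, fun i => ?_, rfl⟩
  have h := PosSemidef.dotProduct_nonneg hS (Uᵀ i)
  have h1 : Uᵀ *ᵥ Uᵀ i = Pi.single i 1 := by
    ext j
    have := congrFun (congrFun (transpose_mul_self_of_mem hU) j) i
    rw [Matrix.one_apply] at this
    rw [Pi.single_apply, ← this]
    rfl
  rw [← Matrix.mulVec_mulVec, ← Matrix.mulVec_mulVec, Matrix.dotProduct_mulVec,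
    ← Matrix.mulVec_transpose, h1] at h
  simpa using h

theorem trace_mul_nonneg_of_posSemidef {A S : Matrix (Fin m) (Fin m) ℝ}
    (hA : ∀ v, 0 ≤ v ⬝ᵥ A *ᵥ v) (hS : S.PosSemidef) : 0 ≤ (A * S).trace := by
  obtain ⟨U, hU, d, hd, rfl⟩ := PosSemidef.exists_diagonal hS
  rw [trace_mul_conj_diagonal]
  exact Finset.sum_nonneg fun i _ => mul_nonneg (hA _) (hd i)

/-- The nuclear norm of `[Z 0]` is attained by pairing with a contraction, whose compression to a
square matrix has trace at most `tr Z` against `Z`. -/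
theorem nuclearNorm_mul_diagZero_le_trace (hmq : m ≤ q) {Z : Matrix (Fin m) (Fin m) ℝ}
    (hZ : Z.PosSemidef) : nuclearNorm (Z * idZero m q) ≤ Z.trace := by
  set J := idZero m q with hJ
  obtain ⟨U, hU, V, hV, σ, hσ, h⟩ := exists_svd hmq (Z * J)
  set G := U * J * Vᵀ with hG
  have hGc : IsContraction G :=
    (isContraction_diagZero hmq fun i => ⟨zero_le_one, le_rfl⟩).conj hU hV
  have h1 : nuclearNorm (Z * J) = frobInner G (Z * J) := by
    rw [h, nuclearNorm_of_svd hmq hU hV hσ, frobInner_conj hU hV, hJ, idZero,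
      frobInner_diagZero hmq]
    simp [diagZero]
  have h2 : frobInner G (Z * J) = (J * Gᵀ * Z).trace := by
    rw [frobInner, ← Matrix.mul_assoc, Matrix.trace_mul_comm, Matrix.mul_assoc]
  have h3 : 0 ≤ ((1 - J * Gᵀ) * Z).trace := by
    refine trace_mul_nonneg_of_posSemidef (fun v => ?_) hZ
    rw [Matrix.sub_mulVec, Matrix.one_mulVec, dotProduct_sub, ← Matrix.mulVec_mulVec]
    have h4 := hGc v (Jᵀ *ᵥ v)
    have h5 : v ⬝ᵥ J *ᵥ (Gᵀ *ᵥ v) = v ⬝ᵥ G *ᵥ (Jᵀ *ᵥ v) := by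
      rw [Matrix.dotProduct_mulVec, ← Matrix.mulVec_transpose, Matrix.dotProduct_mulVec v G,
        ← Matrix.mulVec_transpose, dotProduct_comm]
    have h6 : (Jᵀ *ᵥ v) ⬝ᵥ (Jᵀ *ᵥ v) = v ⬝ᵥ v := by
      rw [Matrix.mulVec_transpose J v, ← Matrix.dotProduct_mulVec, ← Matrix.mulVec_transpose,
        Matrix.mulVec_mulVec, hJ, idZero_mul_transpose hmq, Matrix.one_mulVec]
    rw [h6] at h4
    rw [h5]
    linarith
  rw [Matrix.sub_mul, Matrix.one_mul, Matrix.trace_sub] at h3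
  rw [h1, h2]
  linarith

end Matrices

/-! ### The proximal mapping of the nuclear norm -/

section Prox

variable {m q : ℕ} {ρ : ℝ}

/-- The optimality condition `X - Z ∈ ρ ∂‖·‖_* (Z)`, with the subgradient `G` described by
duality. -/
def IsProxCertificate (ρ : ℝ) (X Z G : Matrix (Fin m) (Fin q) ℝ) : Prop :=
  (∀ Y, frobInner G Y ≤ nuclearNorm Y) ∧ nuclearNorm Z ≤ frobInner G Z ∧ X = Z + ρ • G

/-- The objective function grows quadratically away from a certified point. -/
theorem IsProxCertificate.add_le (hρ : 0 < ρ) {X Z G : Matrix (Fin m) (Fin q) ℝ}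
    (h : IsProxCertificate ρ X Z G) (Y : Matrix (Fin m) (Fin q) ℝ) :
    ρ * nuclearNorm Z + 1 / 2 * ‖Z - X‖ ^ 2 + 1 / 2 * ‖Y - Z‖ ^ 2 ≤
      ρ * nuclearNorm Y + 1 / 2 * ‖Y - X‖ ^ 2 := by
  obtain ⟨h1, h2, rfl⟩ := h
  have e1 : Z - (Z + ρ • G) = -(ρ • G) := by abel
  have e2 : Y - (Z + ρ • G) = (Y - Z) - ρ • G := by abel
  rw [e1, e2, norm_neg, norm_sub_sq_eq_frobInner (Y - Z), frobInner_comm, frobInner_smul_left,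
    frobInner_sub_right]
  nlinarith [h1 Y]

theorem IsProxCertificate.isProxPoint (hρ : 0 < ρ) {X Z G : Matrix (Fin m) (Fin q) ℝ}
    (h : IsProxCertificate ρ X Z G) : IsProxPoint (fun B => ρ * nuclearNorm B) X Z := by
  intro Y
  have := h.add_le hρ Y
  have := sq_nonneg ‖Y - Z‖
  simp only
  linarith

theorem IsProxCertificate.eq_of_isProxPoint (hρ : 0 < ρ) {X Z G Y : Matrix (Fin m) (Fin q) ℝ}
    (h : IsProxCertificate ρ X Z G) (hY : IsProxPoint (fun B => ρ * nuclearNorm B) X Y) :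
    Y = Z := by
  have h1 := h.add_le hρ Y
  have h2 := hY Z
  simp only at h2
  have h3 : ‖Y - Z‖ ^ 2 = 0 := le_antisymm (by linarith) (sq_nonneg _)
  rwa [sq_eq_zero_iff, norm_eq_zero, sub_eq_zero] at h3

theorem IsProxCertificate.prox_eq (hρ : 0 < ρ) {X Z G : Matrix (Fin m) (Fin q) ℝ}
    (h : IsProxCertificate ρ X Z G) : prox (fun B => ρ * nuclearNorm B) X = Z :=
  h.eq_of_isProxPoint hρ (Classical.epsilon_spec ⟨Z, h.isProxPoint hρ⟩)

theorem IsProxCertificate.conj (hmq : m ≤ q) {X Z G : Matrix (Fin m) (Fin q) ℝ}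
    (h : IsProxCertificate ρ X Z G)
    {U : Matrix (Fin m) (Fin m) ℝ} (hU : U ∈ Matrix.orthogonalGroup (Fin m) ℝ)
    {V : Matrix (Fin q) (Fin q) ℝ} (hV : V ∈ Matrix.orthogonalGroup (Fin q) ℝ) :
    IsProxCertificate ρ (U * X * Vᵀ) (U * Z * Vᵀ) (U * G * Vᵀ) := by
  obtain ⟨h1, h2, rfl⟩ := h
  refine ⟨fun Y => ?_, ?_, ?_⟩
  · have e : Y = U * (Uᵀ * Y * V) * Vᵀ := by
      rw [← Matrix.mul_assoc, ← Matrix.mul_assoc, mul_transpose_self_of_mem hU, Matrix.one_mul,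
        Matrix.mul_assoc, mul_transpose_self_of_mem hV, Matrix.mul_one]
    rw [e, frobInner_conj hU hV, nuclearNorm_conj hmq hU hV]
    exact h1 _
  · rwa [frobInner_conj hU hV, nuclearNorm_conj hmq hU hV]
  · rw [Matrix.mul_add, Matrix.add_mul, Matrix.mul_smul, Matrix.smul_mul]

/-- Soft-thresholding of the singular values satisfies the optimality condition, the subgradient
being obtained by truncating the singular values at `ρ`. -/
theorem isProxCertificate_of_svd (hmq : m ≤ q) (hρ : 0 < ρ) {U : Matrix (Fin m) (Fin m) ℝ}
    (hU : U ∈ Matrix.orthogonalGroup (Fin m) ℝ) {V : Matrix (Fin q) (Fin q) ℝ}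
    (hV : V ∈ Matrix.orthogonalGroup (Fin q) ℝ) {σ : Fin m → ℝ} (hσ : ∀ i, 0 ≤ σ i) :
    IsProxCertificate ρ (U * diagZero q σ * Vᵀ)
      (U * diagZero q (fun i => max (σ i - ρ) 0) * Vᵀ)
      (U * diagZero q (fun i => min (σ i / ρ) 1) * Vᵀ) := by
  refine IsProxCertificate.conj hmq ⟨?_, ?_, ?_⟩ hU hV
  · exact (isContraction_diagZero hmq fun i =>
      ⟨le_min (div_nonneg (hσ i) hρ.le) zero_le_one, min_le_right _ _⟩).frobInner_le hmq
  · have h1 := nuclearNorm_of_svd hmq (one_mem (Matrix.orthogonalGroup (Fin m) ℝ))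
      (one_mem (Matrix.orthogonalGroup (Fin q) ℝ)) (σ := fun i => max (σ i - ρ) 0)
      (fun i => le_max_right _ _)
    rw [Matrix.one_mul, Matrix.transpose_one, Matrix.mul_one] at h1
    rw [h1, frobInner_diagZero hmq]
    refine Finset.sum_le_sum fun i _ => ?_
    simp only [diagZero, Matrix.of_apply, Fin.val_castLE, if_true]
    rcases le_total (σ i) ρ with h | h
    · rw [max_eq_right (by linarith)]
      simp
    · rw [min_eq_right ((one_le_div hρ).2 h), one_mul]
  · ext i j
    simp only [diagZero, Matrix.add_apply, Matrix.smul_apply, Matrix.of_apply, smul_eq_mul]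
    split_ifs with hij
    · rcases le_total (σ i) ρ with h | h
      · rw [max_eq_right (by linarith), min_eq_left ((div_le_one hρ).2 h)]
        field_simp
        ring
      · rw [max_eq_left (by linarith), min_eq_right ((one_le_div hρ).2 h)]
        ring
    · simp

theorem exists_isProxCertificate (hmq : m ≤ q) (hρ : 0 < ρ) (X : Matrix (Fin m) (Fin q) ℝ) :
    ∃ G, IsProxCertificate ρ X (prox (fun B => ρ * nuclearNorm B) X) G := by
  obtain ⟨U, hU, V, hV, σ, hσ, rfl⟩ := exists_svd hmq X
  have h := isProxCertificate_of_svd hmq hρ hU hV hσ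
  exact ⟨_, (h.prox_eq hρ).symm ▸ h⟩

theorem prox_wellDefined (hmq : m ≤ q) (hρ : 0 < ρ) (X : Matrix (Fin m) (Fin q) ℝ) :
    (∃! Z, IsProxPoint (fun B => ρ * nuclearNorm B) X Z) ∧
      IsProxPoint (fun B => ρ * nuclearNorm B) X (prox (fun B => ρ * nuclearNorm B) X) := by
  obtain ⟨G, hG⟩ := exists_isProxCertificate hmq hρ X
  exact ⟨⟨_, hG.isProxPoint hρ, fun Y hY => hG.eq_of_isProxPoint hρ hY⟩, hG.isProxPoint hρ⟩

/-- Nonexpansiveness follows from the monotonicity of the subdifferential. -/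
theorem lipschitzWith_prox (hmq : m ≤ q) (hρ : 0 < ρ) :
    LipschitzWith 1
      (prox (fun B : Matrix (Fin m) (Fin q) ℝ => ρ * nuclearNorm B)) := by
  refine LipschitzWith.of_dist_le_mul fun X Y => ?_
  obtain ⟨G, hG1, hG2, hG3⟩ := exists_isProxCertificate hmq hρ X
  obtain ⟨H, hH1, hH2, hH3⟩ := exists_isProxCertificate hmq hρ Y
  set A := prox (fun B => ρ * nuclearNorm B) X
  set B := prox (fun B => ρ * nuclearNorm B) Y
  have h1 : 0 ≤ frobInner (G - H) (A - B) := by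
    rw [frobInner_sub_left, frobInner_sub_right, frobInner_sub_right]
    linarith [hG1 B, hH1 A]
  have h2 : ‖A - B‖ ^ 2 ≤ ‖X - Y‖ * ‖A - B‖ := by
    refine le_trans ?_ (frobInner_le_norm_mul_norm _ _)
    have e : X - Y = (A - B) + ρ • (G - H) := by
      rw [hG3, hH3, smul_sub]; abel
    rw [e, frobInner_add_left, frobInner_smul_left, norm_sq_eq_frobInner]
    nlinarith
  rw [NNReal.coe_one, one_mul, dist_eq_norm, dist_eq_norm]
  rcases (norm_nonneg (A - B)).eq_or_lt with h | h
  · rw [← h]; positivity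
  · rw [pow_two] at h2
    exact le_of_mul_le_mul_right h2 h

end Prox

/-! ### Projection onto the cone of positive semidefinite matrices -/

section PosPart

variable {m : ℕ}

/-- `Z` is the positive part of the symmetric part of `S`. -/
def IsPosPart (S Z : Matrix (Fin m) (Fin m) ℝ) : Prop :=
  Z.PosSemidef ∧ (Z - (1 / 2 : ℝ) • (S + Sᵀ)).PosSemidef ∧
    (Z - (1 / 2 : ℝ) • (S + Sᵀ)) * Z = 0

theorem exists_isPosPart (S : Matrix (Fin m) (Fin m) ℝ) : ∃ Z, IsPosPart S Z := by
  obtain ⟨U, hU, d, hd⟩ := exists_orthogonal_diagonal (S := (1 / 2 : ℝ) • (S + Sᵀ))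
    (by simp [add_comm])
  have key : ∀ e : Fin m → ℝ, (∀ i, 0 ≤ e i) → (U * Matrix.diagonal e * Uᵀ).PosSemidef := by
    intro e he
    have := (Matrix.posSemidef_diagonal_iff.2 he).mul_mul_conjTranspose_same U
    rwa [Matrix.conjTranspose_eq_transpose_of_trivial] at this
  have h1 : U * Matrix.diagonal (fun i => max (d i) 0) * Uᵀ - (1 / 2 : ℝ) • (S + Sᵀ) =
      U * Matrix.diagonal (fun i => max (d i) 0 - d i) * Uᵀ := by
    rw [hd, ← Matrix.diagonal_sub, Matrix.mul_sub, Matrix.sub_mul]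
  refine ⟨U * Matrix.diagonal (fun i => max (d i) 0) * Uᵀ, key _ fun i => le_max_right _ _, ?_, ?_⟩
  · rw [h1]
    exact key _ fun i => sub_nonneg.2 (le_max_left _ _)
  · rw [h1]
    simp only [Matrix.mul_assoc]
    rw [← Matrix.mul_assoc Uᵀ U, transpose_mul_self_of_mem hU, Matrix.one_mul,
      ← Matrix.mul_assoc (Matrix.diagonal _) (Matrix.diagonal _), Matrix.diagonal_mul_diagonal]
    have : (fun i => (max (d i) 0 - d i) * max (d i) 0) = 0 := by
      ext i
      rcases le_total (d i) 0 with h | h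
      · simp [h]
      · simp [h]
    rw [this]
    simp

/-- The projection of (the symmetric part of) a matrix onto the positive semidefinite cone. -/
def posPart (S : Matrix (Fin m) (Fin m) ℝ) : Matrix (Fin m) (Fin m) ℝ :=
  (exists_isPosPart S).choose

theorem isPosPart_posPart (S : Matrix (Fin m) (Fin m) ℝ) : IsPosPart S (posPart S) :=
  (exists_isPosPart S).choose_spec

theorem frobInner_nonneg_of_posSemidef {A B : Matrix (Fin m) (Fin m) ℝ} (hA : A.PosSemidef)
    (hB : B.PosSemidef) : 0 ≤ frobInner A B := by
  rw [frobInner, PosSemidef.transpose_eq hA]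
  exact trace_mul_nonneg_of_posSemidef (PosSemidef.dotProduct_nonneg hA) hB

/-- The projection onto a convex cone is nonexpansive; in particular the positive part is unique. -/
theorem IsPosPart.norm_sub_le {S T Y Z : Matrix (Fin m) (Fin m) ℝ} (hY : IsPosPart S Y)
    (hZ : IsPosPart T Z) : ‖Y - Z‖ ≤ ‖S - T‖ := by
  obtain ⟨hY1, hY2, hY3⟩ := hY
  obtain ⟨hZ1, hZ2, hZ3⟩ := hZ
  set S' := (1 / 2 : ℝ) • (S + Sᵀ) with hS'
  set T' := (1 / 2 : ℝ) • (T + Tᵀ) with hT'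
  have h1 : ‖S' - T'‖ ≤ ‖S - T‖ := by
    have e : S' - T' = (1 / 2 : ℝ) • ((S - T) + (S - T)ᵀ) := by
      rw [hS', hT', ← smul_sub, Matrix.transpose_sub]
      congr 1
      abel
    rw [e, norm_smul]
    have := norm_add_le (S - T) (S - T)ᵀ
    rw [Matrix.frobenius_norm_transpose] at this
    rw [Real.norm_of_nonneg (by norm_num)]
    linarith
  refine le_trans ?_ h1
  have z1 : frobInner (Y - S') Y = 0 := by
    rw [frobInner, PosSemidef.transpose_eq hY2, hY3, Matrix.trace_zero]
  have z2 : frobInner (Z - T') Z = 0 := by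
    rw [frobInner, PosSemidef.transpose_eq hZ2, hZ3, Matrix.trace_zero]
  have p1 := frobInner_nonneg_of_posSemidef hY2 hZ1
  have p2 := frobInner_nonneg_of_posSemidef hZ2 hY1
  have h2 : 0 ≤ ‖S' - T'‖ ^ 2 - ‖Y - Z‖ ^ 2 := by
    have e : S' - T' = (Y - Z) - ((Y - S') - (Z - T')) := by abel
    have h3 : 0 ≤ frobInner ((Y - S') - (Z - T')) ((Y - S') - (Z - T')) := by
      rw [← norm_sq_eq_frobInner]; positivity
    have h4 : frobInner ((Y - S') - (Z - T')) (Y - Z) ≤ 0 := by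
      rw [frobInner_sub_right, frobInner_sub_left (Y - S') (Z - T'),
        frobInner_sub_left (Y - S') (Z - T')]
      linarith
    rw [e, norm_sub_sq_eq_frobInner, norm_sq_eq_frobInner (Y - S' - (Z - T')),
      frobInner_comm (Y - Z)]
    linarith
  exact (pow_le_pow_iff_left₀ (norm_nonneg _) (norm_nonneg _) two_ne_zero).1 (by linarith)

theorem IsPosPart.posPart_eq {S Z : Matrix (Fin m) (Fin m) ℝ} (h : IsPosPart S Z) :
    posPart S = Z := by
  have := (isPosPart_posPart S).norm_sub_le h
  rw [sub_self, norm_zero] at this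
  exact sub_eq_zero.1 (norm_le_zero_iff.1 this)

theorem lipschitzWith_posPart :
    LipschitzWith 1 (posPart : Matrix (Fin m) (Fin m) ℝ → Matrix (Fin m) (Fin m) ℝ) := by
  refine LipschitzWith.of_dist_le_mul fun S T => ?_
  rw [NNReal.coe_one, one_mul, dist_eq_norm, dist_eq_norm]
  exact (isPosPart_posPart S).norm_sub_le (isPosPart_posPart T)

theorem posPart_smul (t : ℝ) (ht : 0 ≤ t) (S : Matrix (Fin m) (Fin m) ℝ) :
    posPart (t • S) = t • posPart S := by
  refine IsPosPart.posPart_eq ?_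
  obtain ⟨h1, h2, h3⟩ := isPosPart_posPart S
  have e : t • posPart S - (1 / 2 : ℝ) • (t • S + (t • S)ᵀ) =
      t • (posPart S - (1 / 2 : ℝ) • (S + Sᵀ)) := by
    rw [Matrix.transpose_smul, ← smul_add, smul_comm, smul_sub]
  refine ⟨h1.smul ht, ?_, ?_⟩
  · rw [e]; exact h2.smul ht
  · rw [e, Matrix.smul_mul, Matrix.mul_smul, h3, smul_zero, smul_zero]

theorem posPart_zero : posPart (0 : Matrix (Fin m) (Fin m) ℝ) = 0 := by
  simpa using posPart_smul 0 le_rfl (0 : Matrix (Fin m) (Fin m) ℝ)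

theorem norm_posPart_sub_le (S : Matrix (Fin m) (Fin m) ℝ) (hS : Sᵀ = S) :
    ‖posPart S - S‖ ≤ ‖S‖ := by
  obtain ⟨h1, h2, h3⟩ := isPosPart_posPart S
  have e : (1 / 2 : ℝ) • (S + Sᵀ) = S := by rw [hS, ← two_smul ℝ S, smul_smul]; norm_num
  rw [e] at h2 h3
  have h4 : frobInner (posPart S - S) (posPart S) = 0 := by
    rw [frobInner, PosSemidef.transpose_eq h2, h3, Matrix.trace_zero]
  have h5 : ‖S‖ ^ 2 = ‖posPart S - S‖ ^ 2 + ‖posPart S‖ ^ 2 := by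
    have e1 : S = posPart S - (posPart S - S) := by abel
    nth_rewrite 1 [e1]
    rw [norm_sub_sq_eq_frobInner, frobInner_comm, h4]
    ring
  exact (pow_le_pow_iff_left₀ (norm_nonneg _) (norm_nonneg _) two_ne_zero).1
    (by nlinarith [sq_nonneg ‖posPart S‖])

/-- The positive part inherits zero columns. -/
theorem posPart_mulVec_eq_zero {S : Matrix (Fin m) (Fin m) ℝ} (hS : Sᵀ = S) {v : Fin m → ℝ}
    (hv : S *ᵥ v = 0) : posPart S *ᵥ v = 0 := by
  obtain ⟨h1, h2, h3⟩ := isPosPart_posPart S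
  have e : (1 / 2 : ℝ) • (S + Sᵀ) = S := by rw [hS, ← two_smul ℝ S, smul_smul]; norm_num
  rw [e] at h2 h3
  have h4 : posPart S * (posPart S - S) = 0 := by
    have := congrArg Matrix.transpose h3
    rwa [Matrix.transpose_mul, PosSemidef.transpose_eq h1, PosSemidef.transpose_eq h2,
      Matrix.transpose_zero] at this
  have h5 : posPart S *ᵥ (posPart S *ᵥ v) = 0 := by
    have := congrArg (fun A => A *ᵥ v) h4
    simpa [← Matrix.mulVec_mulVec, Matrix.sub_mulVec, hv] using this
  have h6 : (posPart S *ᵥ v) ⬝ᵥ (posPart S *ᵥ v) = 0 := by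
    rw [Matrix.dotProduct_mulVec, ← Matrix.mulVec_transpose, PosSemidef.transpose_eq h1, h5,
      zero_dotProduct]
  exact dotProduct_self_eq_zero.1 h6

end PosPart

/-! ### The proximal mapping at block diagonal matrices -/

section Block

variable {m q : ℕ} {ρ : ℝ} {σ : Fin m → ℝ}

open Classical in
/-- The vector `v` with the entries outside `p` replaced by zero. -/
def restrict {ι : Type*} (p : ι → Prop) (v : ι → ℝ) : ι → ℝ := fun i => if p i then v i else 0

theorem dotProduct_restrict_add {n : ℕ} (p p' : Fin n → Prop) (hp : ∀ i, ¬ (p i ∧ p' i))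
    (v : Fin n → ℝ) :
    restrict p v ⬝ᵥ restrict p v + restrict p' v ⬝ᵥ restrict p' v ≤ v ⬝ᵥ v := by
  simp only [dotProduct, ← Finset.sum_add_distrib, restrict]
  refine Finset.sum_le_sum fun i _ => ?_
  have := hp i
  have := mul_self_nonneg (v i)
  split_ifs <;> simp_all

theorem dotProduct_mulVec_restrict {A : Matrix (Fin m) (Fin q) ℝ} {p : Fin m → Prop}
    {r : Fin q → Prop} (h : ∀ i j, ¬ (p i ∧ r j) → A i j = 0) (v : Fin m → ℝ) (w : Fin q → ℝ) :
    v ⬝ᵥ A *ᵥ w = restrict p v ⬝ᵥ A *ᵥ restrict r w := by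
  simp only [dotProduct, Matrix.mulVec, Finset.mul_sum, restrict]
  refine Finset.sum_congr rfl fun i _ => Finset.sum_congr rfl fun j _ => ?_
  by_cases hi : p i <;> by_cases hj : r j <;> simp [hi, hj, h i j]

theorem dotProduct_mulVec_le_norm (A : Matrix (Fin m) (Fin q) ℝ) (v : Fin m → ℝ)
    (w : Fin q → ℝ) : v ⬝ᵥ A *ᵥ w ≤ ‖A‖ * ((v ⬝ᵥ v + w ⬝ᵥ w) / 2) := by
  have h1 : v ⬝ᵥ A *ᵥ w = frobInner A (Matrix.vecMulVec v w) := by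
    simp only [frobInner_eq_sum, dotProduct, Matrix.mulVec, Finset.mul_sum, Matrix.vecMulVec_apply]
    exact Finset.sum_congr rfl fun i _ => Finset.sum_congr rfl fun j _ => by ring
  have h2 : ‖Matrix.vecMulVec v w‖ ^ 2 = (v ⬝ᵥ v) * (w ⬝ᵥ w) := by
    simp only [norm_sq_eq_frobInner, frobInner_eq_sum, dotProduct, Matrix.vecMulVec_apply,
      Finset.sum_mul_sum]
    exact Finset.sum_congr rfl fun i _ => Finset.sum_congr rfl fun j _ => by ring
  rw [h1]
  refine (frobInner_le_norm_mul_norm _ _).trans (mul_le_mul_of_nonneg_left ?_ (norm_nonneg _))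
  have h3 : 0 ≤ v ⬝ᵥ v := Finset.sum_nonneg fun _ _ => mul_self_nonneg _
  have h4 : 0 ≤ w ⬝ᵥ w := Finset.sum_nonneg fun _ _ => mul_self_nonneg _
  refine abs_le_of_sq_le_sq' ?_ (by positivity) |>.2
  rw [h2]
  nlinarith [sq_nonneg (v ⬝ᵥ v - w ⬝ᵥ w)]

theorem dotProduct_restrict_self_nonneg {ι : Type*} [Fintype ι] (p : ι → Prop) (v : ι → ℝ) :
    0 ≤ restrict p v ⬝ᵥ restrict p v :=
  Finset.sum_nonneg fun _ _ => mul_self_nonneg _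

theorem idZero_mulVec_self_le (hmq : m ≤ q) {p : Fin m → Prop} {r : Fin q → Prop}
    (h : ∀ i, p i → r (Fin.castLE hmq i)) (w : Fin q → ℝ) :
    restrict p (idZero m q *ᵥ w) ⬝ᵥ restrict p (idZero m q *ᵥ w) ≤
      restrict r w ⬝ᵥ restrict r w := by
  have h1 : restrict p (idZero m q *ᵥ w) ⬝ᵥ restrict p (idZero m q *ᵥ w) ≤
      ∑ i, restrict r w (Fin.castLE hmq i) * restrict r w (Fin.castLE hmq i) := by
    refine Finset.sum_le_sum fun i _ => ?_
    simp only [restrict, idZero, diagZero_mulVec hmq, one_mul]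
    by_cases hi : p i
    · simp [hi, h i hi]
    · simp only [hi, if_false, zero_mul]
      exact mul_self_nonneg _
  refine h1.trans ?_
  have h2 := Finset.sum_map Finset.univ (Fin.castLEEmb hmq)
    fun j => restrict r w j * restrict r w j
  simp only [Fin.coe_castLEEmb] at h2
  rw [← h2]
  exact Finset.sum_le_sum_of_subset_of_nonneg (Finset.subset_univ _)
    fun _ _ _ => mul_self_nonneg _

theorem posSemidef_dotProduct_mulVec_le {F : Matrix (Fin m) (Fin m) ℝ} (hF : F.PosSemidef)
    (v w : Fin m → ℝ) : v ⬝ᵥ F *ᵥ w ≤ (v ⬝ᵥ F *ᵥ v + w ⬝ᵥ F *ᵥ w) / 2 := by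
  have h := PosSemidef.dotProduct_nonneg hF (v - w)
  have h1 : w ⬝ᵥ F *ᵥ v = v ⬝ᵥ F *ᵥ w := by
    rw [Matrix.dotProduct_mulVec, ← Matrix.mulVec_transpose, PosSemidef.transpose_eq hF,
      dotProduct_comm]
  rw [Matrix.mulVec_sub, dotProduct_sub, sub_dotProduct, sub_dotProduct, h1] at h
  linarith

theorem posPart_apply_eq_zero {S : Matrix (Fin m) (Fin m) ℝ} (hS : Sᵀ = S) {p : Fin m → Prop}
    (h : ∀ i j, ¬ (p i ∧ p j) → S i j = 0) (i j : Fin m) (hij : ¬ (p i ∧ p j)) :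
    posPart S i j = 0 := by
  have key : ∀ i j, ¬ p j → posPart S i j = 0 := by
    intro i j hj
    have h1 : S *ᵥ Pi.single j 1 = 0 := by
      ext k
      simp [h k j fun h => hj h.2]
    have := congrFun (posPart_mulVec_eq_zero hS h1) i
    simpa using this
  by_cases hj : p j
  · have hi : ¬ p i := fun hi => hij ⟨hi, hj⟩
    rw [← PosSemidef.transpose_eq (isPosPart_posPart S).1]
    exact key j i hi
  · exact key i j hj

/-- The singular values `σ`, extended by zero to all columns. -/
def extendZero (q : ℕ) (σ : Fin m → ℝ) (j : Fin q) : ℝ :=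
  if h : (j : ℕ) < m then σ ⟨j, h⟩ else 0

@[simp]
theorem extendZero_castLE (hmq : m ≤ q) (σ : Fin m → ℝ) (i : Fin m) :
    extendZero q σ (Fin.castLE hmq i) = σ i := by
  simp [extendZero]

/-- A small block diagonal perturbation of `[Diag σ 0]`, with symmetric blocks `D₁` and `D₂` on the
indices where `σ > ρ` and `σ = ρ`: its first block is shifted by `-ρ`, its second one is replaced
by the positive part `N` of `D₂`, and its third one is annihilated. The subgradient is
`F [1 0] + ρ⁻¹ T`, where `T` is the third block, and where `F` is the identity on the first block
and the identity minus `ρ⁻¹ (N - D₂)` on the second one. -/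
theorem isProxCertificate_block (hmq : m ≤ q) (hρ : 0 < ρ) (hσ : ∀ i, 0 ≤ σ i)
    {D₁ D₂ : Matrix (Fin m) (Fin m) ℝ} {D₃ : Matrix (Fin m) (Fin q) ℝ}
    (hs₁ : D₁ᵀ = D₁) (hs₂ : D₂ᵀ = D₂)
    (h₁ : ∀ i j, ¬ (ρ < σ i ∧ ρ < σ j) → D₁ i j = 0)
    (h₂ : ∀ i j, ¬ (σ i = ρ ∧ σ j = ρ) → D₂ i j = 0)
    (h₃ : ∀ i j, ¬ (σ i < ρ ∧ extendZero q σ j < ρ) → D₃ i j = 0)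
    {g c : ℝ} (hg : ∀ i, ρ < σ i → g ≤ σ i - ρ) (hD₁ : ‖D₁‖ ≤ g) (hD₂ : ‖D₂‖ ≤ ρ)
    (hc0 : 0 ≤ c) (hc : ∀ i, σ i < ρ → σ i ≤ c) (hD₃ : ‖D₃‖ ≤ ρ - c) :
    ∃ G, IsProxCertificate ρ (diagZero q σ + (D₁ + D₂) * idZero m q + D₃)
      (diagZero q (fun i => max (σ i - ρ) 0) + (D₁ + posPart D₂) * idZero m q) G := by
  classical
  set J := idZero m q with hJ
  set N := posPart D₂ with hN
  obtain ⟨hN1, hN2, hN3⟩ := isPosPart_posPart D₂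
  have e2 : (1 / 2 : ℝ) • (D₂ + D₂ᵀ) = D₂ := by
    rw [hs₂, ← two_smul ℝ D₂, smul_smul]; norm_num
  rw [← hN] at hN1 hN2 hN3
  rw [e2] at hN2 hN3
  have hNs : ∀ i j, ¬ (σ i = ρ ∧ σ j = ρ) → N i j = 0 := posPart_apply_eq_zero hs₂ h₂
  set e : Fin m → ℝ := fun i => if ρ ≤ σ i then 1 else 0 with he
  set t : Fin m → ℝ := fun i => if σ i < ρ then σ i else 0 with ht
  set S₁ := Matrix.diagonal (fun i => max (σ i - ρ) 0) + D₁ with hS₁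
  set F := Matrix.diagonal e - ρ⁻¹ • (N - D₂) with hF
  set T := diagZero q t + D₃ with hT
  have hFs : Fᵀ = F := by
    rw [hF, Matrix.transpose_sub, Matrix.diagonal_transpose, Matrix.transpose_smul,
      PosSemidef.transpose_eq hN2]
  have hquad : ∀ v, v ⬝ᵥ F *ᵥ v = restrict (fun i => ρ ≤ σ i) v ⬝ᵥ restrict (fun i => ρ ≤ σ i) v -
      ρ⁻¹ * (v ⬝ᵥ (N - D₂) *ᵥ v) := by
    intro v
    rw [hF, Matrix.sub_mulVec, dotProduct_sub, Matrix.smul_mulVec, dotProduct_smul, smul_eq_mul]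
    congr 1
    refine Finset.sum_congr rfl fun i _ => ?_
    simp only [Matrix.mulVec_diagonal, he, restrict]
    split_ifs <;> ring
  have hFle : ∀ v, v ⬝ᵥ F *ᵥ v ≤
      restrict (fun i => ρ ≤ σ i) v ⬝ᵥ restrict (fun i => ρ ≤ σ i) v := by
    intro v
    rw [hquad]
    have := mul_nonneg (inv_nonneg.2 hρ.le) (PosSemidef.dotProduct_nonneg hN2 v)
    linarith
  -- Here the smallness of `D₂` enters: `N - D₂` is at most `ρ`.
  have hFpsd : F.PosSemidef := by
    refine posSemidef_of_dotProduct_nonneg hFs fun v => ?_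
    have h5 := dotProduct_mulVec_restrict (A := N - D₂) (p := fun i => ρ ≤ σ i)
      (r := fun i => ρ ≤ σ i) (fun i j hij => by
        have : ¬ (σ i = ρ ∧ σ j = ρ) := fun h => hij ⟨h.1.ge, h.2.ge⟩
        rw [Matrix.sub_apply, hNs i j this, h₂ i j this, sub_zero]) v v
    have h6 := dotProduct_mulVec_le_norm (N - D₂) (restrict (fun i => ρ ≤ σ i) v)
      (restrict (fun i => ρ ≤ σ i) v)
    have h7 : ‖N - D₂‖ ≤ ρ := (norm_posPart_sub_le D₂ hs₂).trans hD₂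
    have h8 := dotProduct_restrict_self_nonneg (fun i => ρ ≤ σ i) v
    rw [hquad, h5]
    set a := restrict (fun i => ρ ≤ σ i) v ⬝ᵥ restrict (fun i => ρ ≤ σ i) v
    have h9 : ρ⁻¹ * (restrict (fun i => ρ ≤ σ i) v ⬝ᵥ (N - D₂) *ᵥ restrict (fun i => ρ ≤ σ i) v)
        ≤ ρ⁻¹ * (ρ * a) := by
      refine mul_le_mul_of_nonneg_left (h6.trans ?_) (inv_nonneg.2 hρ.le)
      rw [show (a + a) / 2 = a by ring]
      exact mul_le_mul_of_nonneg_right h7 h8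
    rw [inv_mul_cancel_left₀ hρ.ne'] at h9
    linarith
  -- The eigenvalues of the first block stay positive, as `D₁` is smaller than the gap `g`.
  have hS₁psd : S₁.PosSemidef := by
    refine posSemidef_of_dotProduct_nonneg ?_ fun v => ?_
    · rw [hS₁, Matrix.transpose_add, Matrix.diagonal_transpose, hs₁]
    rw [hS₁, Matrix.add_mulVec, dotProduct_add, dotProduct_mulVec_restrict (A := D₁) h₁]
    have h5 := dotProduct_mulVec_le_norm (-D₁) (restrict (fun i => ρ < σ i) v)
      (restrict (fun i => ρ < σ i) v)
    rw [Matrix.neg_mulVec, dotProduct_neg, norm_neg] at h5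
    have h6 : g * (restrict (fun i => ρ < σ i) v ⬝ᵥ restrict (fun i => ρ < σ i) v) ≤
        v ⬝ᵥ Matrix.diagonal (fun i => max (σ i - ρ) 0) *ᵥ v := by
      rw [dotProduct, Finset.mul_sum]
      refine Finset.sum_le_sum fun i _ => ?_
      simp only [Matrix.mulVec_diagonal, restrict]
      split_ifs with hi
      · rw [max_eq_left (by linarith)]
        nlinarith [hg i hi, mul_self_nonneg (v i)]
      · have := mul_nonneg (le_max_right (σ i - ρ) 0) (mul_self_nonneg (v i))
        linarith
    have h8 := dotProduct_restrict_self_nonneg (fun i => ρ < σ i) v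
    nlinarith
  have hZ : diagZero q (fun i => max (σ i - ρ) 0) + (D₁ + N) * J = (S₁ + N) * J := by
    rw [diagZero_eq, hS₁, ← Matrix.add_mul, add_assoc]
  refine ⟨F * J + ρ⁻¹ • T, ?_, ?_, ?_⟩
  · refine IsContraction.frobInner_le hmq fun v w => ?_
    rw [Matrix.add_mulVec, dotProduct_add, ← Matrix.mulVec_mulVec]
    have h5 := posSemidef_dotProduct_mulVec_le hFpsd v (J *ᵥ w)
    have h6 := hFle v
    have h7 := (hFle (J *ᵥ w)).trans (idZero_mulVec_self_le hmq
      (r := fun j => ρ ≤ extendZero q σ j) (by simp) w)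
    have hTs : ∀ i j, ¬ (σ i < ρ ∧ extendZero q σ j < ρ) → T i j = 0 := by
      intro i j hij
      rw [hT, Matrix.add_apply, h₃ i j hij, add_zero]
      simp only [diagZero, Matrix.of_apply, ht]
      split_ifs with h h'
      · exfalso
        refine hij ⟨h', ?_⟩
        have : j = Fin.castLE hmq i := Fin.ext h.symm
        rw [this, extendZero_castLE]
        exact h'
      · rfl
      · rfl
    set v' := restrict (fun i => σ i < ρ) v with hv'
    set w' := restrict (fun j => extendZero q σ j < ρ) w with hw'
    have h8 : v ⬝ᵥ (ρ⁻¹ • T) *ᵥ w = ρ⁻¹ * (v' ⬝ᵥ T *ᵥ w') := by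
      rw [Matrix.smul_mulVec, dotProduct_smul, smul_eq_mul, dotProduct_mulVec_restrict hTs]
    have hv0 : 0 ≤ v' ⬝ᵥ v' := dotProduct_restrict_self_nonneg _ v
    have hw0 : 0 ≤ w' ⬝ᵥ w' := dotProduct_restrict_self_nonneg _ w
    -- The third block has norm at most `c` before and at most `ρ` after the perturbation.
    have h9 : v' ⬝ᵥ diagZero q t *ᵥ w' ≤ c * ((v' ⬝ᵥ v' + w' ⬝ᵥ w') / 2) := by
      rcases hc0.eq_or_lt with rfl | hcpos
      · have ht0 : t = fun _ => 0 := by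
          ext i
          simp only [ht]
          split_ifs with hi
          · exact le_antisymm (hc i hi) (hσ i)
          · rfl
        have : diagZero q t = 0 := by
          ext i j
          simp [diagZero, ht0]
        simp [this]
      · have h10 := isContraction_diagZero hmq (g := fun i => t i / c) (fun i => by
          simp only [ht]
          split_ifs with hi
          · exact ⟨div_nonneg (hσ i) hc0, (div_le_one hcpos).2 (hc i hi)⟩
          · simp) v' w'
        have h11 : diagZero q t = c • diagZero q (fun i => t i / c) := by
          ext i j
          simp only [diagZero, Matrix.of_apply, Matrix.smul_apply, smul_eq_mul]
          split_ifs
          · field_simp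
          · simp
        rw [h11, Matrix.smul_mulVec, dotProduct_smul, smul_eq_mul]
        exact mul_le_mul_of_nonneg_left h10 hc0
    have h10 : v' ⬝ᵥ T *ᵥ w' ≤ ρ * ((v' ⬝ᵥ v' + w' ⬝ᵥ w') / 2) := by
      rw [hT, Matrix.add_mulVec, dotProduct_add]
      have h11 := dotProduct_mulVec_le_norm D₃ v' w'
      nlinarith
    have h11 : ρ⁻¹ * (v' ⬝ᵥ T *ᵥ w') ≤ (v' ⬝ᵥ v' + w' ⬝ᵥ w') / 2 := by
      rwa [inv_mul_le_iff₀ hρ]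
    have h12 := dotProduct_restrict_add (fun i => ρ ≤ σ i) (fun i => σ i < ρ)
      (fun i h => absurd h.1 (not_le.2 h.2)) v
    have h13 := dotProduct_restrict_add (fun j => ρ ≤ extendZero q σ j)
      (fun j => extendZero q σ j < ρ) (fun i h => absurd h.1 (not_le.2 h.2)) w
    rw [h8]
    linarith
  · rw [hZ]
    refine (nuclearNorm_mul_diagZero_le_trace hmq (hS₁psd.add hN1)).trans (le_of_eq ?_)
    have hTZ : (S₁ + N) * T = 0 := by
      ext i j
      rw [Matrix.mul_apply]
      refine Finset.sum_eq_zero fun k _ => ?_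
      by_cases hk : σ k < ρ
      · have h5 : S₁ i k = 0 := by
          have hk' : max (σ k - ρ) 0 = 0 := max_eq_right (by linarith)
          rw [hS₁, Matrix.add_apply, h₁ i k (fun h => absurd h.2 (not_lt.2 hk.le)), add_zero,
            Matrix.diagonal_apply]
          split_ifs with hik
          · rw [hik]; exact hk'
          · rfl
        rw [Matrix.add_apply, h5, hNs i k (fun h => hk.ne h.2), add_zero, zero_mul]
      · have h5 : T k j = 0 := by
          rw [hT, Matrix.add_apply, h₃ k j (fun h => hk h.1), add_zero]
          simp [diagZero, ht, hk]
        rw [h5, mul_zero]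
    have hFZ : F * (S₁ + N) = S₁ + N := by
      have h5 : Matrix.diagonal e * (S₁ + N) = S₁ + N := by
        ext i j
        rw [Matrix.diagonal_mul]
        by_cases hi : ρ ≤ σ i
        · simp [he, hi]
        · have hi' := not_le.1 hi
          have h6 : max (σ i - ρ) 0 = 0 := max_eq_right (by linarith)
          have h7 : S₁ i j = 0 := by
            rw [hS₁, Matrix.add_apply, h₁ i j (fun h => absurd h.1 (not_lt.2 hi'.le)), add_zero,
              Matrix.diagonal_apply, h6, ite_self]
          rw [Matrix.add_apply, h7, hNs i j (fun h => hi'.ne h.1)]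
          simp
      have h6 : (N - D₂) * S₁ = 0 := by
        ext i j
        rw [Matrix.mul_apply]
        refine Finset.sum_eq_zero fun k _ => ?_
        by_cases hk : σ k = ρ
        · have h7 : S₁ k j = 0 := by
            have hk' : max (σ k - ρ) 0 = 0 := max_eq_right (by linarith)
            rw [hS₁, Matrix.add_apply, h₁ k j (fun h => absurd h.1 (not_lt.2 hk.le)), add_zero,
              Matrix.diagonal_apply, hk', ite_self]
          rw [h7, mul_zero]
        · rw [Matrix.sub_apply, hNs i k (fun h => hk h.2), h₂ i k (fun h => hk h.2), sub_zero,
            zero_mul]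
      rw [hF, Matrix.sub_mul, h5, Matrix.smul_mul, Matrix.mul_add, h6, hN3, add_zero, smul_zero,
        sub_zero]
    have hsym : (S₁ + N)ᵀ = S₁ + N := PosSemidef.transpose_eq (hS₁psd.add hN1)
    have h5 : (F * J + ρ⁻¹ • T)ᵀ * ((S₁ + N) * J) = Jᵀ * (F * (S₁ + N) * J) := by
      have h6 : Tᵀ * (S₁ + N) = 0 := by
        rw [← hsym, ← Matrix.transpose_mul, hTZ, Matrix.transpose_zero]
      rw [Matrix.transpose_add, Matrix.transpose_smul, Matrix.add_mul, Matrix.smul_mul,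
        ← Matrix.mul_assoc Tᵀ, h6, Matrix.zero_mul, smul_zero, add_zero, Matrix.transpose_mul, hFs]
      simp only [Matrix.mul_assoc]
    rw [frobInner, h5, hFZ, Matrix.trace_mul_comm, Matrix.mul_assoc, hJ, idZero_mul_transpose hmq,
      Matrix.mul_one]
  · have h5 : diagZero q σ = diagZero q (fun i => max (σ i - ρ) 0) + ρ • diagZero q e +
        diagZero q t := by
      ext i j
      simp only [diagZero, Matrix.add_apply, Matrix.smul_apply, Matrix.of_apply, smul_eq_mul, he,
        ht]
      rcases lt_or_ge (σ i) ρ with hi | hi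
      · simp [hi, not_le.2 hi, hi.le]
      · simp only [max_eq_left (sub_nonneg.2 hi), not_lt.2 hi, hi, if_true, if_false]
        split_ifs <;> ring
    have h6 : ρ • F = ρ • Matrix.diagonal e - (N - D₂) := by
      rw [hF, smul_sub, smul_smul, mul_inv_cancel₀ hρ.ne', one_smul]
    rw [smul_add, smul_smul, mul_inv_cancel₀ hρ.ne', one_smul, ← Matrix.smul_mul, h6, h5,
      diagZero_eq e, ← Matrix.smul_mul, hT]
    simp only [Matrix.add_mul, Matrix.sub_mul]
    abel

end Block

/-! ### Calculus of matrix products and exponentials -/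

section Calculus

/-- Continuous linear maps for the topologies induced by the norms of `E` and `F`.  For matrices,
where `E →L[ℝ] F` would pick the product topology, this keeps a single (definitionally equal)
choice throughout. -/
abbrev NormedCLM (E F : Type*) [NormedAddCommGroup E] [NormedSpace ℝ E] [NormedAddCommGroup F]
    [NormedSpace ℝ F] := E →L[ℝ] F

/-- A linear function on a finite-dimensional space as a continuous linear map. -/
def clmOfLinear {E F : Type*} [NormedAddCommGroup E] [NormedSpace ℝ E] [NormedAddCommGroup F]
    [NormedSpace ℝ F] [FiniteDimensional ℝ E] (f : E → F) (hadd : ∀ x y, f (x + y) = f x + f y)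
    (hsmul : ∀ (r : ℝ) x, f (r • x) = r • f x) : NormedCLM E F :=
  LinearMap.toContinuousLinearMap ⟨⟨f, hadd⟩, hsmul⟩

theorem clmOfLinear_apply {E F : Type*} [NormedAddCommGroup E] [NormedSpace ℝ E]
    [NormedAddCommGroup F] [NormedSpace ℝ F] [FiniteDimensional ℝ E] (f : E → F)
    (hadd : ∀ x y, f (x + y) = f x + f y) (hsmul : ∀ (r : ℝ) x, f (r • x) = r • f x) (x : E) :
    clmOfLinear f hadd hsmul x = f x := rfl

/-- The identity of a normed space. -/
def idCLM (E : Type*) [NormedAddCommGroup E] [NormedSpace ℝ E] : NormedCLM E E :=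
  ContinuousLinearMap.id ℝ E

theorem idCLM_apply {E : Type*} [NormedAddCommGroup E] [NormedSpace ℝ E] (x : E) :
    idCLM E x = x := rfl

attribute [local instance] Matrix.frobeniusNormedRing Matrix.frobeniusNormedAlgebra

theorem NormedCLM.eventually_norm_le {E F : Type*} [NormedAddCommGroup E] [NormedSpace ℝ E]
    [NormedAddCommGroup F] [NormedSpace ℝ F] (L : NormedCLM E F) {r : ℝ} (hr : 0 < r) :
    ∀ᶠ x in 𝓝 (0 : E), ‖L x‖ ≤ r := by
  have : Tendsto (fun x => ‖L x‖) (𝓝 0) (𝓝 0) := by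
    simpa using L.continuous.norm.tendsto 0
  exact (this.eventually (gt_mem_nhds hr)).mono fun x => le_of_lt

/-- The inverse function theorem at a point where the differential is the identity. -/
theorem ContDiffAt.exists_local_inverse {E : Type*} [NormedAddCommGroup E] [NormedSpace ℝ E]
    [CompleteSpace E] {f : E → E} {x y : E} (hf : ContDiffAt ℝ 2 f x)
    (hf' : HasFDerivAt f (idCLM E) x) (hy : f x = y) :
    ∃ ψ : E → E, ContDiffAt ℝ 2 ψ y ∧ ψ y = x ∧ HasFDerivAt ψ (idCLM E) y ∧
      ∀ᶠ z in 𝓝 y, f (ψ z) = z := by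
  subst hy
  have h1 : HasFDerivAt f (ContinuousLinearEquiv.refl ℝ E : E →L[ℝ] E) x := hf'
  have h3 := hf.hasStrictFDerivAt' h1 (by simp)
  exact ⟨hf.localInverse h1 (by simp), hf.to_localInverse h1 (by simp),
    hf.localInverse_apply_image h1 (by simp), h3.to_localInverse.hasFDerivAt,
    h3.eventually_right_inverse⟩

theorem isBoundedBilinearMap_matrix_mul (a b c : ℕ) :
    IsBoundedBilinearMap ℝ
      (fun p : Matrix (Fin a) (Fin b) ℝ × Matrix (Fin b) (Fin c) ℝ => p.1 * p.2) where
  add_left _ _ _ := Matrix.add_mul _ _ _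
  smul_left _ _ _ := Matrix.smul_mul _ _ _
  add_right _ _ _ := Matrix.mul_add _ _ _
  smul_right _ _ _ := Matrix.mul_smul _ _ _
  bound := ⟨1, one_pos, fun A B => by
    rw [one_mul]; exact Matrix.frobenius_norm_mul A B⟩

variable {E : Type*} [NormedAddCommGroup E] [NormedSpace ℝ E] {a b c d : ℕ}

theorem ContDiff.matrix_mul {k : WithTop ℕ∞} {A : E → Matrix (Fin a) (Fin b) ℝ}
    {B : E → Matrix (Fin b) (Fin c) ℝ} (hA : ContDiff ℝ k A) (hB : ContDiff ℝ k B) :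
    ContDiff ℝ k fun x => A x * B x :=
  (isBoundedBilinearMap_matrix_mul a b c).contDiff.comp (hA.prodMk hB)

theorem hasFDerivAt_matrix_mul_mul {A : E → Matrix (Fin a) (Fin b) ℝ}
    {M : E → Matrix (Fin b) (Fin c) ℝ} {B : E → Matrix (Fin c) (Fin d) ℝ}
    {A' : NormedCLM E (Matrix (Fin a) (Fin b) ℝ)} {M' : NormedCLM E (Matrix (Fin b) (Fin c) ℝ)}
    {B' : NormedCLM E (Matrix (Fin c) (Fin d) ℝ)} {x : E} (hA : HasFDerivAt A A' x)
    (hM : HasFDerivAt M M' x) (hB : HasFDerivAt B B' x) {L : NormedCLM E (Matrix (Fin a) (Fin d) ℝ)}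
    (hL : ∀ h, L h = A' h * M x * B x + A x * M' h * B x + A x * M x * B' h) :
    HasFDerivAt (fun y => A y * M y * B y) L x := by
  have h1 := ((isBoundedBilinearMap_matrix_mul a b c).hasFDerivAt (A x, M x)).comp x
    (hA.prodMk hM)
  have h2 := ((isBoundedBilinearMap_matrix_mul a c d).hasFDerivAt (A x * M x, B x)).comp x
    (h1.prodMk hB)
  refine h2.congr_fderiv ?_
  ext1 h
  simp only [ContinuousLinearMap.comp_apply, ContinuousLinearMap.prod_apply,
    IsBoundedBilinearMap.deriv_apply, hL]
  rw [Matrix.add_mul]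
  abel

theorem contDiff_exp (n : ℕ) (k : WithTop ℕ∞) :
    ContDiff ℝ k (NormedSpace.exp : Matrix (Fin n) (Fin n) ℝ → Matrix (Fin n) (Fin n) ℝ) :=
  contDiff_iff_contDiffAt.2 fun x => (NormedSpace.exp_analytic (𝕂 := ℝ) x).contDiffAt

theorem hasFDerivAt_exp_comp {n : ℕ} (K : NormedCLM E (Matrix (Fin n) (Fin n) ℝ)) :
    HasFDerivAt (fun x => NormedSpace.exp (K x)) K 0 := by
  have h : HasFDerivAt (NormedSpace.exp : Matrix (Fin n) (Fin n) ℝ → _)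
      (idCLM (Matrix (Fin n) (Fin n) ℝ)) (K 0) := by
    rw [map_zero]
    exact hasFDerivAt_exp_zero
  exact h.comp 0 K.hasFDerivAt

/-- The exponential of a skew-symmetric matrix is orthogonal. -/
theorem exp_mem_orthogonalGroup {n : ℕ} {K : Matrix (Fin n) (Fin n) ℝ} (hK : Kᵀ = -K) :
    NormedSpace.exp K ∈ Matrix.orthogonalGroup (Fin n) ℝ := by
  rw [Matrix.mem_orthogonalGroup_iff, ← Matrix.exp_transpose, hK,
    ← Matrix.exp_add_of_commute _ _ (Commute.neg_right (Commute.refl K)), add_neg_cancel,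
    NormedSpace.exp_zero]

end Calculus

/-! ### A smooth parametrization near a diagonal matrix -/

section Param

variable {m q : ℕ}

/-- The linear map `H ↦ (a i j * H i j + ε * a j i * H j i)`, for `ε = ±1`. -/
def symmMap (hmq : m ≤ q) (ε : ℝ) (a : Fin m → Fin m → ℝ) :
    NormedCLM (Matrix (Fin m) (Fin q) ℝ) (Matrix (Fin m) (Fin m) ℝ) :=
  clmOfLinear
    (fun H => Matrix.of fun i j =>
        a i j * H i (Fin.castLE hmq j) + ε * (a j i * H j (Fin.castLE hmq i)))
    (fun H K => by
        ext i j; simp only [Matrix.of_apply, Matrix.add_apply]; ring)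
    (fun r H => by
        ext i j
        simp only [Matrix.of_apply, Matrix.smul_apply, smul_eq_mul]; ring)

theorem symmMap_apply (hmq : m ≤ q) (ε : ℝ) (a : Fin m → Fin m → ℝ)
    (H : Matrix (Fin m) (Fin q) ℝ) (i j : Fin m) :
    symmMap hmq ε a H i j =
      a i j * H i (Fin.castLE hmq j) + ε * (a j i * H j (Fin.castLE hmq i)) := rfl

theorem symmMap_one_transpose (hmq : m ≤ q) (a : Fin m → Fin m → ℝ)
    (H : Matrix (Fin m) (Fin q) ℝ) : (symmMap hmq 1 a H)ᵀ = symmMap hmq 1 a H := by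
  ext i j
  rw [Matrix.transpose_apply, symmMap_apply, symmMap_apply]
  ring

theorem symmMap_neg_one_transpose (hmq : m ≤ q) (a : Fin m → Fin m → ℝ)
    (H : Matrix (Fin m) (Fin q) ℝ) : (symmMap hmq (-1) a H)ᵀ = -symmMap hmq (-1) a H := by
  ext i j
  rw [Matrix.transpose_apply, Matrix.neg_apply, symmMap_apply, symmMap_apply]
  ring

/-- The entrywise product with `a`, as a linear map. -/
def hadamardMap (a : Fin m → Fin q → ℝ) :
    NormedCLM (Matrix (Fin m) (Fin q) ℝ) (Matrix (Fin m) (Fin q) ℝ) :=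
  clmOfLinear
    (fun H => Matrix.of fun i j => a i j * H i j)
    (fun H K => by
        ext i j; simp only [Matrix.of_apply, Matrix.add_apply]; ring)
    (fun r H => by
        ext i j
        simp only [Matrix.of_apply, Matrix.smul_apply, smul_eq_mul]; ring)

theorem hadamardMap_apply (a : Fin m → Fin q → ℝ) (H : Matrix (Fin m) (Fin q) ℝ) (i : Fin m)
    (j : Fin q) : hadamardMap a H i j = a i j * H i j := rfl

/-- The skew-symmetric matrix `K - Kᵀ`, where `K` is obtained from the entrywise product of `a`
and `H` by appending zero rows. -/
def skewMap (a : Fin m → Fin q → ℝ) :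
    NormedCLM (Matrix (Fin m) (Fin q) ℝ) (Matrix (Fin q) (Fin q) ℝ) :=
  clmOfLinear
    (fun H => (idZero m q)ᵀ * hadamardMap a H - ((idZero m q)ᵀ * hadamardMap a H)ᵀ)
    (fun H K => by
        rw [map_add, Matrix.mul_add, Matrix.transpose_add]; abel)
    (fun r H => by
        rw [map_smul, Matrix.mul_smul, Matrix.transpose_smul, smul_sub])

theorem skewMap_apply (a : Fin m → Fin q → ℝ) (H : Matrix (Fin m) (Fin q) ℝ) :
    skewMap a H = (idZero m q)ᵀ * hadamardMap a H - ((idZero m q)ᵀ * hadamardMap a H)ᵀ := rfl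

theorem skewMap_transpose (a : Fin m → Fin q → ℝ) (H : Matrix (Fin m) (Fin q) ℝ) :
    (skewMap a H)ᵀ = -skewMap a H := by
  rw [skewMap_apply, Matrix.transpose_sub, Matrix.transpose_transpose, neg_sub]

theorem idZero_transpose_mul_apply (hmq : m ≤ q) (A : Matrix (Fin m) (Fin q) ℝ) (i : Fin m)
    (j : Fin q) : ((idZero m q)ᵀ * A) (Fin.castLE hmq i) j = A i j := by
  rw [← Matrix.transpose_transpose A, ← Matrix.transpose_mul, Matrix.transpose_apply, idZero,
    mul_diagZero_apply hmq, mul_one, Matrix.transpose_transpose, Matrix.transpose_apply]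

theorem idZero_transpose_mul_apply_of_le (A : Matrix (Fin m) (Fin q) ℝ) {i : Fin q} (hi : m ≤ i)
    (j : Fin q) : ((idZero m q)ᵀ * A) i j = 0 := by
  rw [← Matrix.transpose_transpose A, ← Matrix.transpose_mul, Matrix.transpose_apply, idZero,
    mul_diagZero_apply_of_le _ _ _ hi]

theorem skewMap_castLE_castLE (hmq : m ≤ q) (a : Fin m → Fin q → ℝ)
    (H : Matrix (Fin m) (Fin q) ℝ) (i j : Fin m) :
    skewMap a H (Fin.castLE hmq i) (Fin.castLE hmq j) =
      a i (Fin.castLE hmq j) * H i (Fin.castLE hmq j) -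
        a j (Fin.castLE hmq i) * H j (Fin.castLE hmq i) := by
  rw [skewMap_apply, Matrix.sub_apply, Matrix.transpose_apply, idZero_transpose_mul_apply,
    idZero_transpose_mul_apply, hadamardMap_apply, hadamardMap_apply]

theorem skewMap_castLE_of_le (hmq : m ≤ q) (a : Fin m → Fin q → ℝ)
    (H : Matrix (Fin m) (Fin q) ℝ) (i : Fin m) {j : Fin q} (hj : m ≤ j) :
    skewMap a H (Fin.castLE hmq i) j = a i j * H i j := by
  rw [skewMap_apply, Matrix.sub_apply, Matrix.transpose_apply, idZero_transpose_mul_apply,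
    idZero_transpose_mul_apply_of_le _ hj, hadamardMap_apply, sub_zero]

/-- Two singular values lie on the same side of the threshold `ρ`, or are both equal to it. -/
def SameBlock (ρ x y : ℝ) : Prop := (ρ < x ∧ ρ < y) ∨ (x = ρ ∧ y = ρ) ∨ (x < ρ ∧ y < ρ)

open Classical in
/-- Coefficients of the infinitesimal left rotation; `x` and `y` are the singular values attached
to the row and the column of the entry.  Off the diagonal blocks, the coefficients of both
rotations solve the linear system saying that together they produce the given entries. -/
def coefU (ρ x y : ℝ) : ℝ := if SameBlock ρ x y then 0 else y / (y ^ 2 - x ^ 2)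

open Classical in
/-- Coefficients of the infinitesimal right rotation.  Inside the blocks `> ρ` and `= ρ` it is
chosen so that the remaining diagonal block is symmetric. -/
def coefV (ρ x y : ℝ) : ℝ :=
  if SameBlock ρ x y then (if x < ρ then 0 else -1 / (x + y)) else x / (y ^ 2 - x ^ 2)

open Classical in
/-- Coefficients of the symmetric perturbation of the block `> ρ`. -/
def coefGt (ρ x y : ℝ) : ℝ := if ρ < x ∧ ρ < y then y / (x + y) else 0

open Classical in
/-- Coefficients of the symmetric perturbation of the block `= ρ`. -/
def coefEq (ρ x y : ℝ) : ℝ := if x = ρ ∧ y = ρ then 1 / 2 else 0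

open Classical in
/-- Coefficients of the perturbation of the block `< ρ`. -/
def coefLt (ρ x y : ℝ) : ℝ := if x < ρ ∧ y < ρ then 1 else 0

variable (hmq : m ≤ q) (ρ : ℝ) (σ : Fin m → ℝ)

/-- The infinitesimal left rotation, a skew-symmetric `m × m` matrix. -/
def rotU : NormedCLM (Matrix (Fin m) (Fin q) ℝ) (Matrix (Fin m) (Fin m) ℝ) :=
  symmMap hmq (-1) fun i j => coefU ρ (σ i) (σ j)

/-- The infinitesimal right rotation, a skew-symmetric `q × q` matrix. -/
def rotV (q : ℕ) (ρ : ℝ) (σ : Fin m → ℝ) :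
    NormedCLM (Matrix (Fin m) (Fin q) ℝ) (Matrix (Fin q) (Fin q) ℝ) :=
  skewMap fun i j => coefV ρ (σ i) (extendZero q σ j)

/-- The symmetric perturbation of the block `> ρ`. -/
def blockGt : NormedCLM (Matrix (Fin m) (Fin q) ℝ) (Matrix (Fin m) (Fin m) ℝ) :=
  symmMap hmq 1 fun i j => coefGt ρ (σ i) (σ j)

/-- The symmetric perturbation of the block `= ρ`. -/
def blockEq : NormedCLM (Matrix (Fin m) (Fin q) ℝ) (Matrix (Fin m) (Fin m) ℝ) :=
  symmMap hmq 1 fun i j => coefEq ρ (σ i) (σ j)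

/-- The perturbation of the block `< ρ`, to which the last `q - m` columns belong. -/
def blockLt (q : ℕ) (ρ : ℝ) (σ : Fin m → ℝ) :
    NormedCLM (Matrix (Fin m) (Fin q) ℝ) (Matrix (Fin m) (Fin q) ℝ) :=
  hadamardMap fun i j => coefLt ρ (σ i) (extendZero q σ j)

/-- The parametrization of matrices near `[Diag σ 0]` by two rotations and a block diagonal
perturbation, all depending linearly on `H`. -/
def param (H : Matrix (Fin m) (Fin q) ℝ) : Matrix (Fin m) (Fin q) ℝ :=
  NormedSpace.exp (rotU hmq ρ σ H) *
    (diagZero q σ + (blockGt hmq ρ σ H + blockEq hmq ρ σ H) * idZero m q + blockLt q ρ σ H) *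
    (NormedSpace.exp (rotV q ρ σ H))ᵀ

/-- The proximal point of `param H`, as a smooth function of `H` and of the positive part `n` of
the block `= ρ`. -/
def paramProx (p : Matrix (Fin m) (Fin q) ℝ × Matrix (Fin m) (Fin m) ℝ) :
    Matrix (Fin m) (Fin q) ℝ :=
  NormedSpace.exp (rotU hmq ρ σ p.1) *
    (diagZero q (fun i => max (σ i - ρ) 0) + (blockGt hmq ρ σ p.1 + p.2) * idZero m q) *
    (NormedSpace.exp (rotV q ρ σ p.1))ᵀ

theorem param_zero : param hmq ρ σ 0 = diagZero q σ := by
  simp [param, NormedSpace.exp_zero]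

/-- The transposition of square matrices as a continuous linear map. -/
def transposeMap (n : ℕ) : NormedCLM (Matrix (Fin n) (Fin n) ℝ) (Matrix (Fin n) (Fin n) ℝ) :=
  clmOfLinear Matrix.transpose Matrix.transpose_add Matrix.transpose_smul

theorem transposeMap_apply {n : ℕ} (A : Matrix (Fin n) (Fin n) ℝ) : transposeMap n A = Aᵀ := rfl

/-- Right multiplication by a fixed matrix as a continuous linear map. -/
def mulRightMap {a b c : ℕ} (B : Matrix (Fin b) (Fin c) ℝ) :
    NormedCLM (Matrix (Fin a) (Fin b) ℝ) (Matrix (Fin a) (Fin c) ℝ) :=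
  clmOfLinear
    (fun A => A * B)
    (fun _ _ => Matrix.add_mul _ _ _)
    (fun _ _ => Matrix.smul_mul _ _ _)

theorem mulRightMap_apply {a b c : ℕ} (B : Matrix (Fin b) (Fin c) ℝ)
    (A : Matrix (Fin a) (Fin b) ℝ) : mulRightMap B A = A * B := rfl

theorem contDiff_param (k : WithTop ℕ∞) : ContDiff ℝ k (param hmq ρ σ) := by
  refine ContDiff.matrix_mul (ContDiff.matrix_mul
    ((contDiff_exp m k).comp (rotU hmq ρ σ).contDiff) ?_)
    ((transposeMap q).contDiff.comp ((contDiff_exp q k).comp (rotV q ρ σ).contDiff))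
  exact (contDiff_const.add (ContDiff.matrix_mul
    ((blockGt hmq ρ σ).contDiff.add (blockEq hmq ρ σ).contDiff) contDiff_const)).add
    (blockLt q ρ σ).contDiff

theorem contDiff_paramProx (k : WithTop ℕ∞) : ContDiff ℝ k (paramProx hmq ρ σ) := by
  refine ContDiff.matrix_mul (ContDiff.matrix_mul
    ((contDiff_exp m k).comp ((rotU hmq ρ σ).contDiff.comp contDiff_fst)) ?_)
    ((transposeMap q).contDiff.comp
      ((contDiff_exp q k).comp ((rotV q ρ σ).contDiff.comp contDiff_fst)))
  exact contDiff_const.add (ContDiff.matrix_mul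
    (((blockGt hmq ρ σ).contDiff.comp contDiff_fst).add contDiff_snd) contDiff_const)

theorem hasFDerivAt_exp_rotV_transpose (q : ℕ) (ρ : ℝ) (σ : Fin m → ℝ) :
    HasFDerivAt (fun H => (NormedSpace.exp (rotV q ρ σ H))ᵀ)
      ((transposeMap q).comp (rotV q ρ σ)) 0 :=
  (transposeMap q).hasFDerivAt.comp 0 (hasFDerivAt_exp_comp (rotV q ρ σ))

variable {ρ σ}

theorem sq_sub_sq_ne_zero_of_not_sameBlock {x y : ℝ} (hx : 0 ≤ x) (hy : 0 ≤ y)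
    (h : ¬ SameBlock ρ x y) : y ^ 2 - x ^ 2 ≠ 0 ∧ x ^ 2 - y ^ 2 ≠ 0 := by
  have hxy : x ≠ y := by
    rintro rfl
    apply h
    rcases lt_trichotomy x ρ with h' | h' | h'
    · exact Or.inr (Or.inr ⟨h', h'⟩)
    · exact Or.inr (Or.inl ⟨h', h'⟩)
    · exact Or.inl ⟨h', h'⟩
  have h1 : 0 < x + y := by
    rcases hx.eq_or_lt with h' | h'
    · rcases hy.eq_or_lt with h'' | h''
      · exact absurd (h'.symm.trans h'') hxy
      · linarith
    · linarith
  have h2 : y ^ 2 - x ^ 2 = (y - x) * (x + y) := by ring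
  have h3 : x ^ 2 - y ^ 2 = (x - y) * (x + y) := by ring
  rw [h2, h3]
  exact ⟨mul_ne_zero (sub_ne_zero.2 hxy.symm) h1.ne', mul_ne_zero (sub_ne_zero.2 hxy) h1.ne'⟩

theorem sameBlock_comm {x y : ℝ} : SameBlock ρ x y ↔ SameBlock ρ y x := by
  simp only [SameBlock, and_comm]

/-- Entrywise, the differential of the parametrization is the identity; `h` and `k` are the entries
of `H` at `(i, j)` and at `(j, i)`. -/
theorem coef_identity (hρ : 0 < ρ) {x y : ℝ} (hx : 0 ≤ x) (hy : 0 ≤ y) (h k : ℝ) :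
    (coefU ρ x y * h + -1 * (coefU ρ y x * k)) * y - x * (coefV ρ x y * h - coefV ρ y x * k) +
      (coefGt ρ x y * h + 1 * (coefGt ρ y x * k)) + (coefEq ρ x y * h + 1 * (coefEq ρ y x * k)) +
      coefLt ρ x y * h = h := by
  by_cases hs : SameBlock ρ x y
  · have hs' := sameBlock_comm.1 hs
    simp only [coefU, coefV, coefGt, coefEq, coefLt, hs, hs', if_true]
    rcases hs with ⟨h1, h2⟩ | ⟨h1, h2⟩ | ⟨h1, h2⟩
    · have h3 : x + y ≠ 0 := by linarith
      have h4 : y + x ≠ 0 := by linarith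
      simp only [h1, h2, not_lt.2 h1.le, not_lt.2 h2.le, h1.ne', h2.ne', and_self, if_true,
        if_false]
      field_simp
      ring
    · subst h1
      subst h2
      simp only [lt_irrefl, and_self, if_true, if_false]
      field_simp
      ring
    · simp only [h1, h2, not_lt.2 h1.le, not_lt.2 h2.le, h1.ne, h2.ne, and_self, if_true,
        if_false]
      ring
  · have hs' : ¬ SameBlock ρ y x := fun h => hs (sameBlock_comm.1 h)
    obtain ⟨hd, hd'⟩ := sq_sub_sq_ne_zero_of_not_sameBlock hx hy hs
    have h1 : ¬ (ρ < x ∧ ρ < y) := fun h => hs (Or.inl h)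
    have h2 : ¬ (x = ρ ∧ y = ρ) := fun h => hs (Or.inr (Or.inl h))
    have h3 : ¬ (x < ρ ∧ y < ρ) := fun h => hs (Or.inr (Or.inr h))
    have h1' : ¬ (ρ < y ∧ ρ < x) := fun h => h1 h.symm
    have h2' : ¬ (y = ρ ∧ x = ρ) := fun h => h2 h.symm
    simp only [coefU, coefV, coefGt, coefEq, coefLt, hs, hs', h1, h2, h3, h1', h2', if_false]
    have e : x ^ 2 - y ^ 2 = -(y ^ 2 - x ^ 2) := by ring
    rw [e, div_neg, div_neg]
    field_simp
    ring

/-- The entries of the last `q - m` columns, where the extended singular value is zero. -/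
theorem coef_identity_zero (hρ : 0 < ρ) (x h : ℝ) :
    -(x * (coefV ρ x 0 * h)) + coefLt ρ x 0 * h = h := by
  by_cases h1 : x < ρ
  · have hs : SameBlock ρ x 0 := Or.inr (Or.inr ⟨h1, hρ⟩)
    simp [coefV, coefLt, hs, h1, hρ]
  · have hs : ¬ SameBlock ρ x 0 := by
      rintro (⟨_, h2⟩ | ⟨_, h2⟩ | ⟨h2, _⟩)
      · linarith
      · linarith
      · exact h1 h2
    have hx0 : x ≠ 0 := by linarith
    simp only [coefV, coefLt, hs, h1, false_and, if_false]
    field_simp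
    ring

theorem extendZero_of_le {j : Fin q} (hj : m ≤ j) : extendZero q σ j = 0 := by
  simp [extendZero, not_lt.2 hj]

theorem exists_castLE_eq {j : Fin q} (hj : (j : ℕ) < m) : ∃ i, j = Fin.castLE hmq i :=
  ⟨⟨j, hj⟩, rfl⟩

/-- The differential of the parametrization at the origin is the identity. -/
theorem hasFDerivAt_param (hρ : 0 < ρ) (hσ : ∀ i, 0 ≤ σ i) :
    HasFDerivAt (param hmq ρ σ) (idCLM (Matrix (Fin m) (Fin q) ℝ)) 0 := by
  have hM : HasFDerivAt (fun H => diagZero q σ +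
      (blockGt hmq ρ σ H + blockEq hmq ρ σ H) * idZero m q + blockLt q ρ σ H)
      ((mulRightMap (idZero m q)).comp (blockGt hmq ρ σ + blockEq hmq ρ σ) + blockLt q ρ σ) 0 :=
    ((((mulRightMap (idZero m q)).comp
      (blockGt hmq ρ σ + blockEq hmq ρ σ)).hasFDerivAt).const_add _).add
      (blockLt q ρ σ).hasFDerivAt
  refine hasFDerivAt_matrix_mul_mul (hasFDerivAt_exp_comp (rotU hmq ρ σ)) hM
    (hasFDerivAt_exp_rotV_transpose q ρ σ) fun H => ?_
  simp only [map_zero, NormedSpace.exp_zero, Matrix.transpose_one, Matrix.mul_one, Matrix.one_mul,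
    add_zero, Matrix.zero_mul, ContinuousLinearMap.comp_apply, add_apply,
    mulRightMap_apply, transposeMap_apply, idCLM_apply]
  rw [rotV, skewMap_transpose]
  ext i j
  simp only [Matrix.add_apply, Matrix.mul_neg, Matrix.neg_apply, diagZero_mul_apply hmq]
  rcases lt_or_ge (j : ℕ) m with hj | hj
  · obtain ⟨j, rfl⟩ := exists_castLE_eq hmq hj
    rw [skewMap_castLE_castLE, mul_diagZero_apply, idZero, mul_diagZero_apply, rotU, blockGt,
      blockEq, blockLt, hadamardMap_apply, Matrix.add_apply, symmMap_apply, symmMap_apply,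
      symmMap_apply]
    simp only [extendZero_castLE]
    have := coef_identity hρ (hσ i) (hσ j) (H i (Fin.castLE hmq j)) (H j (Fin.castLE hmq i))
    linarith
  · rw [skewMap_castLE_of_le _ _ _ _ hj, mul_diagZero_apply_of_le _ _ _ hj, idZero,
      mul_diagZero_apply_of_le _ _ _ hj, blockLt, hadamardMap_apply, extendZero_of_le hj]
    have := coef_identity_zero hρ (σ i) (H i j)
    linarith

/-- Near the origin the proximal mapping takes `param H` to `paramProx`. -/
theorem eventually_prox_param (hρ : 0 < ρ) (hσ : ∀ i, 0 ≤ σ i) :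
    ∀ᶠ H in 𝓝 (0 : Matrix (Fin m) (Fin q) ℝ),
      prox (fun B => ρ * nuclearNorm B) (param hmq ρ σ H) =
        paramProx hmq ρ σ (H, posPart (blockEq hmq ρ σ H)) := by
  -- The singular values below and above `ρ` stay away from `ρ` by positive margins `ρ - c` and `g`.
  obtain ⟨c, ⟨hc0, hcρ⟩, hc⟩ : ∃ c, (0 < c ∧ c < ρ) ∧ ∀ i, σ i < ρ → σ i ≤ c := by
    have h1 : ∀ᶠ c in 𝓝[<] ρ, ∀ i, σ i < ρ → σ i ≤ c := by
      rw [eventually_all]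
      intro i
      rcases lt_or_ge (σ i) ρ with hi | hi
      · filter_upwards [Ioo_mem_nhdsLT hi] with c hc _ using hc.1.le
      · exact Eventually.of_forall fun c h => absurd h (not_lt.2 hi)
    exact (Eventually.and (Ioo_mem_nhdsLT hρ) h1).exists
  obtain ⟨g, hg0, hg⟩ : ∃ g, 0 < g ∧ ∀ i, ρ < σ i → g ≤ σ i - ρ := by
    have h1 : ∀ᶠ g in 𝓝[>] (0 : ℝ), ∀ i, ρ < σ i → g ≤ σ i - ρ := by
      rw [eventually_all]
      intro i
      rcases lt_or_ge ρ (σ i) with hi | hi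
      · filter_upwards [Ioo_mem_nhdsGT (sub_pos.2 hi)] with c hc _ using hc.2.le
      · exact Eventually.of_forall fun c h => absurd h (not_lt.2 hi)
    exact ((eventually_mem_nhdsWithin (s := Set.Ioi (0 : ℝ))).and h1).exists
  filter_upwards [(blockGt hmq ρ σ).eventually_norm_le hg0,
    (blockEq hmq ρ σ).eventually_norm_le hρ,
    (blockLt q ρ σ).eventually_norm_le (sub_pos.2 hcρ)] with H h1 h2 h3
  obtain ⟨G, hG⟩ := isProxCertificate_block hmq hρ hσ
    (symmMap_one_transpose hmq _ H : (blockGt hmq ρ σ H)ᵀ = _)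
    (symmMap_one_transpose hmq _ H : (blockEq hmq ρ σ H)ᵀ = _)
    (D₃ := blockLt q ρ σ H)
    (fun i j hij => by
      have hij' : ¬ (ρ < σ j ∧ ρ < σ i) := fun h => hij h.symm
      simp [symmMap_apply, coefGt, hij, hij'])
    (fun i j hij => by
      have hij' : ¬ (σ j = ρ ∧ σ i = ρ) := fun h => hij h.symm
      simp [symmMap_apply, coefEq, hij, hij'])
    (fun i j hij => by simp [blockLt, hadamardMap_apply, coefLt, hij])
    hg h1 h2 hc0.le hc h3
  exact (hG.conj hmq (exp_mem_orthogonalGroup (symmMap_neg_one_transpose hmq _ H))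
    (exp_mem_orthogonalGroup (skewMap_transpose _ H))).prox_eq hρ

/-- A smooth local inverse of the parametrization. -/
theorem exists_local_inverse (hρ : 0 < ρ) (hσ : ∀ i, 0 ≤ σ i) :
    ∃ ψ : Matrix (Fin m) (Fin q) ℝ → Matrix (Fin m) (Fin q) ℝ,
      ContDiffAt ℝ 2 ψ (diagZero q σ) ∧ ψ (diagZero q σ) = 0 ∧
      HasFDerivAt ψ (idCLM (Matrix (Fin m) (Fin q) ℝ)) (diagZero q σ) ∧
      ∀ᶠ X in 𝓝 (diagZero q σ), param hmq ρ σ (ψ X) = X := by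
  exact ContDiffAt.exists_local_inverse (contDiff_param hmq ρ σ 2).contDiffAt
    (hasFDerivAt_param hmq hρ hσ) (param_zero hmq ρ σ)

end Param

/-! ### Strong semismoothness of the proximal mapping -/

section Semismooth

variable {m q : ℕ}

/-- The linear map `X ↦ U X Vᵀ`. -/
def conjMap (U : Matrix (Fin m) (Fin m) ℝ) (V : Matrix (Fin q) (Fin q) ℝ) :
    NormedCLM (Matrix (Fin m) (Fin q) ℝ) (Matrix (Fin m) (Fin q) ℝ) :=
  clmOfLinear (fun X => U * X * Vᵀ)
    (fun X Y => by rw [Matrix.mul_add, Matrix.add_mul])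
    (fun r X => by rw [Matrix.mul_smul, Matrix.smul_mul])

theorem conjMap_apply (U : Matrix (Fin m) (Fin m) ℝ) (V : Matrix (Fin q) (Fin q) ℝ)
    (X : Matrix (Fin m) (Fin q) ℝ) : conjMap U V X = U * X * Vᵀ := rfl

variable {U : Matrix (Fin m) (Fin m) ℝ} {V : Matrix (Fin q) (Fin q) ℝ}

theorem conjMap_transpose_conjMap (hU : U ∈ Matrix.orthogonalGroup (Fin m) ℝ)
    (hV : V ∈ Matrix.orthogonalGroup (Fin q) ℝ) (X : Matrix (Fin m) (Fin q) ℝ) :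
    conjMap Uᵀ Vᵀ (conjMap U V X) = X := by
  rw [conjMap_apply, conjMap_apply, Matrix.transpose_transpose, Matrix.mul_assoc, Matrix.mul_assoc,
    transpose_mul_self_of_mem hV, Matrix.mul_one, ← Matrix.mul_assoc, transpose_mul_self_of_mem hU,
    Matrix.one_mul]

theorem conjMap_conjMap_transpose (hU : U ∈ Matrix.orthogonalGroup (Fin m) ℝ)
    (hV : V ∈ Matrix.orthogonalGroup (Fin q) ℝ) (X : Matrix (Fin m) (Fin q) ℝ) :
    conjMap U V (conjMap Uᵀ Vᵀ X) = X := by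
  have := conjMap_transpose_conjMap (transpose_mem_orthogonalGroup hU)
    (transpose_mem_orthogonalGroup hV) X
  rwa [Matrix.transpose_transpose, Matrix.transpose_transpose] at this

variable {ρ : ℝ} {σ : Fin m → ℝ}

theorem prox_conjMap (hmq : m ≤ q) (hρ : 0 < ρ) (hU : U ∈ Matrix.orthogonalGroup (Fin m) ℝ)
    (hV : V ∈ Matrix.orthogonalGroup (Fin q) ℝ) (X : Matrix (Fin m) (Fin q) ℝ) :
    prox (fun B => ρ * nuclearNorm B) (conjMap U V X) =
      conjMap U V (prox (fun B => ρ * nuclearNorm B) X) := by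
  obtain ⟨G, hG⟩ := exists_isProxCertificate hmq hρ X
  exact (hG.conj hmq hU hV).prox_eq hρ

/-- Near a matrix with given singular value decomposition the proximal mapping is a smooth function
of `X` and of the positive part of a symmetric matrix depending smoothly on `X`. -/
theorem exists_prox_model (hmq : m ≤ q) (hρ : 0 < ρ) (hσ : ∀ i, 0 ≤ σ i)
    (hU : U ∈ Matrix.orthogonalGroup (Fin m) ℝ) (hV : V ∈ Matrix.orthogonalGroup (Fin q) ℝ) :
    ∃ ψ : Matrix (Fin m) (Fin q) ℝ → Matrix (Fin m) (Fin q) ℝ,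
      ContDiffAt ℝ 2 ψ (conjMap U V (diagZero q σ)) ∧ ψ (conjMap U V (diagZero q σ)) = 0 ∧
      HasFDerivAt ψ (conjMap Uᵀ Vᵀ) (conjMap U V (diagZero q σ)) ∧
      ∀ᶠ X in 𝓝 (conjMap U V (diagZero q σ)),
        prox (fun B => ρ * nuclearNorm B) X =
          conjMap U V (paramProx hmq ρ σ (ψ X, posPart (blockEq hmq ρ σ (ψ X)))) := by
  obtain ⟨ψ, h1, h2, h3, h4⟩ := exists_local_inverse hmq hρ hσ
  have e := conjMap_transpose_conjMap hU hV (diagZero q σ)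
  have hc : Tendsto (conjMap Uᵀ Vᵀ) (𝓝 (conjMap U V (diagZero q σ))) (𝓝 (diagZero q σ)) := by
    have := (conjMap Uᵀ Vᵀ).continuous.tendsto (conjMap U V (diagZero q σ))
    rwa [e] at this
  have hψ : Tendsto ψ (𝓝 (diagZero q σ)) (𝓝 0) := by
    have := h1.continuousAt.tendsto
    rwa [h2] at this
  refine ⟨fun X => ψ (conjMap Uᵀ Vᵀ X), ?_, ?_, ?_, ?_⟩
  · rw [← e] at h1
    exact h1.comp (conjMap U V (diagZero q σ)) (conjMap Uᵀ Vᵀ).contDiff.contDiffAt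
  · exact (congrArg ψ e).trans h2
  · rw [← e] at h3
    exact h3.comp _ (conjMap Uᵀ Vᵀ).hasFDerivAt
  · filter_upwards [hc.eventually h4,
      hc.eventually (hψ.eventually (eventually_prox_param hmq hρ hσ))] with X hX1 hX2
    rw [← hX2, hX1, ← prox_conjMap hmq hρ hU hV, conjMap_conjMap_transpose hU hV]

theorem stronglySemismoothAt_prox (hmq : m ≤ q) (hρ : 0 < ρ)
    (X : Matrix (Fin m) (Fin q) ℝ) :
    StronglySemismoothAt (prox (fun B : Matrix (Fin m) (Fin q) ℝ => ρ * nuclearNorm B))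
      (clarkeJacobian (prox (fun B : Matrix (Fin m) (Fin q) ℝ => ρ * nuclearNorm B))) X := by
  obtain ⟨U, hU, V, hV, σ, hσ, rfl⟩ := exists_svd hmq X
  obtain ⟨ψ, h1, h2, -, h4⟩ := exists_prox_model hmq hρ hσ hU hV
  refine stronglySemismoothAt_of_model (lipschitzWith_prox hmq hρ).continuous
    (N := posPart) (b := fun X => blockEq hmq ρ σ (ψ X))
    (R := fun p => conjMap U V (paramProx hmq ρ σ (ψ p.1, p.2)))
    lipschitzWith_posPart posPart_smul h4 ?_ ?_ ?_
  · have h5 : ContDiffAt ℝ 2 (fun p : Matrix (Fin m) (Fin q) ℝ × Matrix (Fin m) (Fin m) ℝ =>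
        (ψ p.1, p.2)) (conjMap U V (diagZero q σ), 0) :=
      (ContDiffAt.comp (g := ψ) (f := Prod.fst) (conjMap U V (diagZero q σ),
        (0 : Matrix (Fin m) (Fin m) ℝ)) h1 contDiffAt_fst).prodMk contDiffAt_snd
    exact (conjMap U V).contDiff.contDiffAt.comp _
      ((contDiff_paramProx hmq ρ σ 2).contDiffAt.comp _ h5)
  · exact (blockEq hmq ρ σ).contDiff.contDiffAt.comp _ h1
  · exact (congrArg (blockEq hmq ρ σ) h2).trans (map_zero _)

end Semismooth

/-! ### The derivative of the proximal mapping off the threshold -/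

section Derivative

variable {m q : ℕ}

/-- The linear map `H ↦ A ⊙ H + [B ⊙ H₁ᵀ 0]`, with `H₁` the first `m` columns of `H`, as a linear
function of the pair `(A, B)`. -/
def mixMap (hmq : m ≤ q) : NormedCLM (Matrix (Fin m) (Fin q) ℝ × Matrix (Fin m) (Fin m) ℝ)
    (NormedCLM (Matrix (Fin m) (Fin q) ℝ) (Matrix (Fin m) (Fin q) ℝ)) :=
  clmOfLinear
    (fun p => clmOfLinear
      (fun H => Matrix.of (fun i j => p.1 i j * H i j) +
        Matrix.of (fun i j => p.2 i j * H j (Fin.castLE hmq i)) * idZero m q)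
      (fun H K => by
        rw [add_add_add_comm, ← Matrix.add_mul]
        congr 1
        · ext i j; simp only [Matrix.of_apply, Matrix.add_apply]; ring
        · congr 1; ext i j; simp only [Matrix.of_apply, Matrix.add_apply]; ring)
      (fun r H => by
        rw [smul_add, ← Matrix.smul_mul]
        congr 1
        · ext i j; simp only [Matrix.of_apply, Matrix.smul_apply, smul_eq_mul]; ring
        · congr 1; ext i j; simp only [Matrix.of_apply, Matrix.smul_apply, smul_eq_mul]; ring))
    (fun p p' => by
      ext1 H
      rw [add_apply, clmOfLinear_apply, clmOfLinear_apply, clmOfLinear_apply, add_add_add_comm,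
        ← Matrix.add_mul]
      congr 1
      · ext i j; simp only [Matrix.of_apply, Matrix.add_apply, Prod.fst_add]; ring
      · congr 1; ext i j; simp only [Matrix.of_apply, Matrix.add_apply, Prod.snd_add]; ring)
    (fun r p => by
      ext1 H
      rw [smul_apply, clmOfLinear_apply, clmOfLinear_apply, smul_add, ← Matrix.smul_mul]
      congr 1
      · ext i j; simp only [Matrix.of_apply, Matrix.smul_apply, smul_eq_mul, Prod.smul_fst]; ring
      · congr 1; ext i j
        simp only [Matrix.of_apply, Matrix.smul_apply, smul_eq_mul, Prod.smul_snd]; ring)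

theorem mixMap_apply (hmq : m ≤ q) (p : Matrix (Fin m) (Fin q) ℝ × Matrix (Fin m) (Fin m) ℝ)
    (H : Matrix (Fin m) (Fin q) ℝ) :
    mixMap hmq p H = Matrix.of (fun i j => p.1 i j * H i j) +
      Matrix.of (fun i j => p.2 i j * H j (Fin.castLE hmq i)) * idZero m q := rfl

theorem mixMap_castLE (hmq : m ≤ q) (p : Matrix (Fin m) (Fin q) ℝ × Matrix (Fin m) (Fin m) ℝ)
    (H : Matrix (Fin m) (Fin q) ℝ) (i j : Fin m) :
    mixMap hmq p H i (Fin.castLE hmq j) =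
      p.1 i (Fin.castLE hmq j) * H i (Fin.castLE hmq j) +
        p.2 i j * H j (Fin.castLE hmq i) := by
  rw [mixMap_apply, Matrix.add_apply, idZero, mul_diagZero_apply hmq, mul_one]
  rfl

theorem mixMap_of_le (hmq : m ≤ q) (p : Matrix (Fin m) (Fin q) ℝ × Matrix (Fin m) (Fin m) ℝ)
    (H : Matrix (Fin m) (Fin q) ℝ) (i : Fin m) {j : Fin q} (hj : m ≤ j) :
    mixMap hmq p H i j = p.1 i j * H i j := by
  rw [mixMap_apply, Matrix.add_apply, idZero, mul_diagZero_apply_of_le _ _ _ hj, add_zero]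
  rfl

open Classical in
/-- The coefficients of `H` and `H₁ᵀ` in the explicit element of the Clarke Jacobian: those of
`H₁` and `H₁ᵀ` are half the sum and half the difference of `gammaAA` and `gammaAG`. -/
def gammaPair (q : ℕ) (ρ : ℝ) (σ : Fin m → ℝ) :
    Matrix (Fin m) (Fin q) ℝ × Matrix (Fin m) (Fin m) ℝ :=
  (Matrix.of fun i j => if h : (j : ℕ) < m then
      (gammaAA ρ σ i ⟨j, h⟩ + gammaAG ρ σ i ⟨j, h⟩) / 2
    else if i ∈ alpha₁ ρ σ then mu ρ σ i else 0,
    Matrix.of fun i j => (gammaAA ρ σ i j - gammaAG ρ σ i j) / 2)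

theorem gammaPair_fst_castLE (hmq : m ≤ q) (ρ : ℝ) (σ : Fin m → ℝ) (i j : Fin m) :
    (gammaPair q ρ σ).1 i (Fin.castLE hmq j) = (gammaAA ρ σ i j + gammaAG ρ σ i j) / 2 := by
  simp [gammaPair]

open Classical in
theorem gammaPair_fst_of_le (ρ : ℝ) (σ : Fin m → ℝ) (i : Fin m) {j : Fin q} (hj : m ≤ j) :
    (gammaPair q ρ σ).1 i j = if i ∈ alpha₁ ρ σ then mu ρ σ i else 0 := by
  simp [gammaPair, not_lt.2 hj]

variable {ρ : ℝ} {σ : Fin m → ℝ}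

theorem mem_alpha₁_iff {i : Fin m} : i ∈ alpha₁ ρ σ ↔ σ i > ρ := Iff.rfl

theorem gammaAA_apply (ρ : ℝ) (σ : Fin m → ℝ) (i j : Fin m) : gammaAA ρ σ i j =
    if σ i > ρ then (if σ j < ρ then tau ρ σ i j else 1)
    else if σ i = ρ then (if σ j > ρ then 1 else 0)
    else (if σ j > ρ then tau ρ σ j i else 0) := by
  classical
  exact if_congr Iff.rfl (if_congr Iff.rfl rfl rfl)
    (if_congr Iff.rfl (if_congr Iff.rfl rfl rfl) (if_congr Iff.rfl rfl rfl))

theorem gammaAG_apply (ρ : ℝ) (σ : Fin m → ℝ) (i j : Fin m) : gammaAG ρ σ i j =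
    if σ i > ρ then omega ρ σ i j else (if σ j > ρ then omega ρ σ j i else 0) := by
  classical
  exact if_congr Iff.rfl rfl (if_congr Iff.rfl rfl rfl)

/-- The entries of the differential of the smooth branch in the first `m` columns; `h` and `k` are
the entries of `H` at `(i, j)` and at `(j, i)`. -/
theorem coef_prox_identity (hρ : 0 < ρ) (hσ : ∀ i, 0 ≤ σ i) (hne : ∀ i, σ i ≠ ρ) (i j : Fin m)
    (h k : ℝ) :
    (coefU ρ (σ i) (σ j) * h + -1 * (coefU ρ (σ j) (σ i) * k)) * max (σ j - ρ) 0 -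
        max (σ i - ρ) 0 * (coefV ρ (σ i) (σ j) * h - coefV ρ (σ j) (σ i) * k) +
        (coefGt ρ (σ i) (σ j) * h + 1 * (coefGt ρ (σ j) (σ i) * k)) =
      (gammaAA ρ σ i j + gammaAG ρ σ i j) / 2 * h +
        (gammaAA ρ σ i j - gammaAG ρ σ i j) / 2 * k := by
  have hx := hσ i
  have hy := hσ j
  simp only [gammaAA_apply, gammaAG_apply, hne, if_false, gt_iff_lt, tau, omega]
  rcases lt_or_gt_of_ne (hne i) with hi | hi <;> rcases lt_or_gt_of_ne (hne j) with hj | hj <;>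
    simp only [hi, hj, not_lt.2 hi.le, not_lt.2 hj.le, if_true, if_false, coefU, coefV, coefGt,
      SameBlock, hne, and_self, and_false, false_and, or_false, false_or] <;>
    generalize σ i = x at * <;> generalize σ j = y at *
  · simp [max_eq_right (sub_neg.2 hi).le, max_eq_right (sub_neg.2 hj).le]
  · have h1 : y - x ≠ 0 := by linarith
    have h2 : y + x ≠ 0 := by linarith
    have h3 : y ^ 2 - x ^ 2 ≠ 0 := by
      rw [sq_sub_sq]; exact mul_ne_zero h2 h1
    have h4 : x ^ 2 - y ^ 2 = -(y ^ 2 - x ^ 2) := by ring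
    rw [max_eq_right (sub_neg.2 hi).le, max_eq_left (sub_pos.2 hj).le, h4, div_neg, div_neg]
    field_simp
    ring
  · have h1 : x - y ≠ 0 := by linarith
    have h2 : x + y ≠ 0 := by linarith
    have h3 : x ^ 2 - y ^ 2 ≠ 0 := by
      rw [sq_sub_sq]; exact mul_ne_zero h2 h1
    have h4 : y ^ 2 - x ^ 2 = -(x ^ 2 - y ^ 2) := by ring
    rw [max_eq_right (sub_neg.2 hj).le, max_eq_left (sub_pos.2 hi).le, h4, div_neg, div_neg]
    field_simp
    ring
  · have h1 : x + y ≠ 0 := by linarith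
    have h2 : y + x ≠ 0 := by linarith
    rw [max_eq_left (sub_pos.2 hi).le, max_eq_left (sub_pos.2 hj).le]
    field_simp
    ring

open Classical in
theorem coef_prox_identity_zero (hρ : 0 < ρ) (i : Fin m) (h : ℝ) :
    -(max (σ i - ρ) 0 * (coefV ρ (σ i) 0 * h)) =
      (if i ∈ alpha₁ ρ σ then mu ρ σ i else 0) * h := by
  rcases le_or_gt (σ i) ρ with hi | hi
  · simp [hi, not_lt.2 hi, mem_alpha₁_iff]
  · have hs : ¬ SameBlock ρ (σ i) 0 := by
      rintro (⟨_, h2⟩ | ⟨_, h2⟩ | ⟨h2, _⟩) <;> linarith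
    have h0 : σ i ≠ 0 := by linarith
    rw [if_pos (mem_alpha₁_iff.2 hi), mu, coefV, if_neg hs, max_eq_left (sub_pos.2 hi).le]
    field_simp
    ring

/-- The differential at the origin of the smooth branch of the proximal mapping, when no singular
value equals `ρ`. -/
theorem hasFDerivAt_paramProx (hmq : m ≤ q) (hρ : 0 < ρ) (hσ : ∀ i, 0 ≤ σ i)
    (hne : ∀ i, σ i ≠ ρ) :
    HasFDerivAt (fun H => paramProx hmq ρ σ (H, 0)) (mixMap hmq (gammaPair q ρ σ)) 0 := by
  have hM : HasFDerivAt (fun H : Matrix (Fin m) (Fin q) ℝ =>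
      diagZero q (fun i => max (σ i - ρ) 0) + (blockGt hmq ρ σ H + 0) * idZero m q)
      ((mulRightMap (idZero m q)).comp (blockGt hmq ρ σ)) 0 := by
    simp only [add_zero]
    exact (((mulRightMap (idZero m q)).comp (blockGt hmq ρ σ)).hasFDerivAt).const_add _
  refine hasFDerivAt_matrix_mul_mul (hasFDerivAt_exp_comp (rotU hmq ρ σ)) hM
    (hasFDerivAt_exp_rotV_transpose q ρ σ) fun H => ?_
  simp only [map_zero, NormedSpace.exp_zero, Matrix.transpose_one, Matrix.mul_one, Matrix.one_mul,
    add_zero, Matrix.zero_mul, ContinuousLinearMap.comp_apply, mulRightMap_apply,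
    transposeMap_apply]
  rw [rotV, skewMap_transpose]
  ext i j
  simp only [Matrix.add_apply, Matrix.mul_neg, Matrix.neg_apply, diagZero_mul_apply hmq]
  rcases lt_or_ge (j : ℕ) m with hj | hj
  · obtain ⟨j, rfl⟩ := exists_castLE_eq hmq hj
    rw [mixMap_castLE, gammaPair_fst_castLE, skewMap_castLE_castLE, mul_diagZero_apply, idZero,
      mul_diagZero_apply, rotU, blockGt, symmMap_apply, symmMap_apply]
    simp only [extendZero_castLE]
    have := coef_prox_identity hρ hσ hne i j (H i (Fin.castLE hmq j)) (H j (Fin.castLE hmq i))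
    simp only [gammaPair, Matrix.of_apply]
    linarith
  · rw [mixMap_of_le _ _ _ _ hj, gammaPair_fst_of_le _ _ _ hj, skewMap_castLE_of_le _ _ _ _ hj,
      mul_diagZero_apply_of_le _ _ _ hj, idZero, mul_diagZero_apply_of_le _ _ _ hj,
      extendZero_of_le hj]
    have := coef_prox_identity_zero (σ := σ) hρ i (H i j)
    linarith

theorem blockEq_eq_zero (hmq : m ≤ q) (hne : ∀ i, σ i ≠ ρ) (H : Matrix (Fin m) (Fin q) ℝ) :
    blockEq hmq ρ σ H = 0 := by
  ext i j
  simp [blockEq, symmMap_apply, coefEq, hne]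

/-- If no singular value equals `ρ`, the proximal mapping is differentiable. -/
theorem hasFDerivAt_prox (hmq : m ≤ q) (hρ : 0 < ρ) (hσ : ∀ i, 0 ≤ σ i) (hne : ∀ i, σ i ≠ ρ)
    {U : Matrix (Fin m) (Fin m) ℝ} (hU : U ∈ Matrix.orthogonalGroup (Fin m) ℝ)
    {V : Matrix (Fin q) (Fin q) ℝ} (hV : V ∈ Matrix.orthogonalGroup (Fin q) ℝ) :
    HasFDerivAt (prox (fun B : Matrix (Fin m) (Fin q) ℝ => ρ * nuclearNorm B))
      ((conjMap U V).comp ((mixMap hmq (gammaPair q ρ σ)).comp (conjMap Uᵀ Vᵀ)))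
      (conjMap U V (diagZero q σ)) := by
  obtain ⟨ψ, -, h2, h3, h4⟩ := exists_prox_model hmq hρ hσ hU hV
  have h5 := hasFDerivAt_paramProx hmq hρ hσ hne
  rw [← h2] at h5
  refine ((conjMap U V).hasFDerivAt.comp _ (h5.comp _ h3)).congr_of_eventuallyEq ?_
  filter_upwards [h4] with X hX
  rw [hX, blockEq_eq_zero hmq hne, posPart_zero]
  rfl

end Derivative

/-! ### An explicit element of the Clarke Jacobian -/

section Element

variable {m q : ℕ} {ρ : ℝ} {σ : Fin m → ℝ}

open Classical in
/-- The singular values `σ`, with those equal to `ρ` lowered by `ε`. -/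
def lowered (ρ : ℝ) (σ : Fin m → ℝ) (ε : ℝ) (i : Fin m) : ℝ := if σ i = ρ then ρ - ε else σ i

theorem lowered_of_ne {i : Fin m} (hi : σ i ≠ ρ) (ε : ℝ) : lowered ρ σ ε i = σ i := if_neg hi

theorem lowered_of_eq {i : Fin m} (hi : σ i = ρ) (ε : ℝ) : lowered ρ σ ε i = ρ - ε := if_pos hi

theorem tendsto_lowered (i : Fin m) :
    Tendsto (fun ε => lowered ρ σ ε i) (𝓝[>] 0) (𝓝 (σ i)) := by
  by_cases hi : σ i = ρ
  · simp only [lowered_of_eq hi, hi]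
    have : Tendsto (fun ε : ℝ => ρ - ε) (𝓝 0) (𝓝 (ρ - 0)) := tendsto_const_nhds.sub tendsto_id
    rw [sub_zero] at this
    exact this.mono_left nhdsWithin_le_nhds
  · simp only [lowered_of_ne hi]
    exact tendsto_const_nhds

theorem lowered_gt_iff {i : Fin m} {ε : ℝ} (hε : 0 < ε) : lowered ρ σ ε i > ρ ↔ σ i > ρ := by
  by_cases hi : σ i = ρ
  · rw [lowered_of_eq hi, hi]
    constructor <;> intro h <;> linarith
  · rw [lowered_of_ne hi]

theorem lowered_ne {i : Fin m} {ε : ℝ} (hε : 0 < ε) : lowered ρ σ ε i ≠ ρ := by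
  by_cases hi : σ i = ρ
  · rw [lowered_of_eq hi]
    linarith
  · rwa [lowered_of_ne hi]

theorem lowered_lt_iff {i : Fin m} {ε : ℝ} (hε : 0 < ε) : lowered ρ σ ε i < ρ ↔ σ i ≤ ρ := by
  rw [lt_iff_le_and_ne, and_iff_left (lowered_ne hε), ← not_lt, ← not_lt]
  exact not_congr (lowered_gt_iff hε)

/-- The limiting value `1` of `tau` as the smaller singular value tends to `ρ`. -/
theorem tendsto_tau_lowered {i j : Fin m} (hi : σ i > ρ) (hj : σ j = ρ) :
    Tendsto (fun ε => tau ρ (lowered ρ σ ε) i j) (𝓝[>] 0) (𝓝 1) := by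
  have h1 : σ i - σ j ≠ 0 := by linarith
  have h2 := (tendsto_lowered (ρ := ρ) (σ := σ) i).sub_const ρ |>.div
    ((tendsto_lowered (ρ := ρ) (σ := σ) i).sub (tendsto_lowered (ρ := ρ) j)) h1
  rwa [hj, div_self (by linarith)] at h2

theorem tendsto_gammaAA (i j : Fin m) :
    Tendsto (fun ε => gammaAA ρ (lowered ρ σ ε) i j) (𝓝[>] 0) (𝓝 (gammaAA ρ σ i j)) := by
  have hform : ∀ᶠ ε in 𝓝[>] (0 : ℝ), gammaAA ρ (lowered ρ σ ε) i j =
      if σ i > ρ then (if σ j ≤ ρ then tau ρ (lowered ρ σ ε) i j else 1)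
      else (if σ j > ρ then tau ρ (lowered ρ σ ε) j i else 0) := by
    filter_upwards [self_mem_nhdsWithin] with ε (hε : 0 < ε)
    simp only [gammaAA_apply, lowered_gt_iff hε, lowered_lt_iff hε, lowered_ne hε, if_false]
  refine Tendsto.congr' (EventuallyEq.symm hform) ?_
  have htau : ∀ {k l : Fin m}, σ k > ρ → σ l ≤ ρ → Tendsto (fun ε => tau ρ (lowered ρ σ ε) k l)
      (𝓝[>] 0) (𝓝 (if σ l = ρ then 1 else tau ρ σ k l)) := by
    intro k l hk hl
    by_cases h : σ l = ρ
    · rw [if_pos h]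
      exact tendsto_tau_lowered hk h
    · simp only [if_neg h, tau, lowered_of_ne h, lowered_of_ne (ne_of_gt hk)]
      exact tendsto_const_nhds
  rw [gammaAA_apply]
  by_cases hi : σ i > ρ
  · simp only [if_pos hi]
    by_cases hj : σ j ≤ ρ
    · simp only [if_pos hj]
      convert htau hi hj using 2
      rcases hj.lt_or_eq with h | h
      · rw [if_pos h, if_neg h.ne]
      · rw [if_neg h.not_lt, if_pos h]
    · simp only [if_neg hj, if_neg fun h => hj (le_of_lt h)]
      exact tendsto_const_nhds
  · simp only [if_neg hi]
    by_cases hj : σ j > ρ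
    · simp only [if_pos hj]
      exact htau hj (not_lt.1 hi)
    · simp only [if_neg hj, ite_self]
      exact tendsto_const_nhds

theorem tendsto_omega_lowered (hρ : 0 < ρ) (hσ : ∀ i, 0 ≤ σ i) {i : Fin m} (j : Fin m)
    (hi : σ i > ρ) :
    Tendsto (fun ε => omega ρ (lowered ρ σ ε) i j) (𝓝[>] 0) (𝓝 (omega ρ σ i j)) := by
  have h1 : σ i + σ j ≠ 0 := by linarith [hσ j]
  have hi' := tendsto_lowered (ρ := ρ) (σ := σ) i
  have hj' := tendsto_lowered (ρ := ρ) (σ := σ) j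
  exact ((hi'.sub_const ρ).add ((hj'.sub_const ρ).max tendsto_const_nhds)).div (hi'.add hj') h1

theorem tendsto_gammaAG (hρ : 0 < ρ) (hσ : ∀ i, 0 ≤ σ i) (i j : Fin m) :
    Tendsto (fun ε => gammaAG ρ (lowered ρ σ ε) i j) (𝓝[>] 0) (𝓝 (gammaAG ρ σ i j)) := by
  have hform : ∀ᶠ ε in 𝓝[>] (0 : ℝ), gammaAG ρ (lowered ρ σ ε) i j =
      if σ i > ρ then omega ρ (lowered ρ σ ε) i j
      else (if σ j > ρ then omega ρ (lowered ρ σ ε) j i else 0) := by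
    filter_upwards [self_mem_nhdsWithin] with ε (hε : 0 < ε)
    simp only [gammaAG_apply, lowered_gt_iff hε]
  refine Tendsto.congr' (EventuallyEq.symm hform) ?_
  rw [gammaAG_apply]
  split_ifs with hi hj
  · exact tendsto_omega_lowered hρ hσ j hi
  · exact tendsto_omega_lowered hρ hσ i hj
  · exact tendsto_const_nhds

theorem tendsto_gammaPair (hmq : m ≤ q) (hρ : 0 < ρ) (hσ : ∀ i, 0 ≤ σ i) :
    Tendsto (fun ε => gammaPair q ρ (lowered ρ σ ε)) (𝓝[>] 0) (𝓝 (gammaPair q ρ σ)) := by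
  refine Tendsto.prodMk_nhds (tendsto_pi_nhds.2 fun i => tendsto_pi_nhds.2 fun j => ?_)
    (tendsto_pi_nhds.2 fun i => tendsto_pi_nhds.2 fun j =>
      ((tendsto_gammaAA (ρ := ρ) (σ := σ) i j).sub (tendsto_gammaAG hρ hσ i j)).div_const 2)
  rcases lt_or_ge (j : ℕ) m with hj | hj
  · obtain ⟨j, rfl⟩ := exists_castLE_eq hmq hj
    have := ((tendsto_gammaAA (ρ := ρ) (σ := σ) i j).add (tendsto_gammaAG hρ hσ i j)).div_const 2
    simp only [← gammaPair_fst_castLE hmq] at this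
    exact this
  · have h1 : ∀ᶠ ε in 𝓝[>] (0 : ℝ),
        (gammaPair q ρ (lowered ρ σ ε)).1 i j = (gammaPair q ρ σ).1 i j := by
      filter_upwards [self_mem_nhdsWithin] with ε (hε : 0 < ε)
      rw [gammaPair_fst_of_le _ _ _ hj, gammaPair_fst_of_le _ _ _ hj]
      simp only [mem_alpha₁_iff, lowered_gt_iff hε, mu]
      split_ifs with hi
      · rw [lowered_of_ne (ne_of_gt hi)]
      · rfl
    exact Tendsto.congr' (EventuallyEq.symm h1) tendsto_const_nhds

theorem continuous_diagZero : Continuous fun s : Fin m → ℝ => diagZero q s := by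
  refine continuous_matrix fun i j => ?_
  simp only [diagZero, Matrix.of_apply]
  split_ifs
  · exact continuous_apply i
  · exact continuous_const

/-- Lowering the singular values equal to `ρ` gives points of differentiability converging to
`U [Diag σ 0] Vᵀ` whose derivatives converge. -/
theorem conj_mixMap_mem_bSubdifferential (hmq : m ≤ q) (hρ : 0 < ρ) (hσ : ∀ i, 0 ≤ σ i)
    {U : Matrix (Fin m) (Fin m) ℝ} (hU : U ∈ Matrix.orthogonalGroup (Fin m) ℝ)
    {V : Matrix (Fin q) (Fin q) ℝ} (hV : V ∈ Matrix.orthogonalGroup (Fin q) ℝ) :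
    ((conjMap U V).comp ((mixMap hmq (gammaPair q ρ σ)).comp (conjMap Uᵀ Vᵀ))) ∈
      bSubdifferential (prox (fun B : Matrix (Fin m) (Fin q) ℝ => ρ * nuclearNorm B))
        (conjMap U V (diagZero q σ)) := by
  -- The amount `ρ / (k + 1)` is at most `ρ`, so that the singular values stay nonnegative.
  set ε : ℕ → ℝ := fun k => ρ * (1 / ((k : ℝ) + 1)) with hε
  have hε0 : ∀ k, 0 < ε k := fun k => by positivity
  have hερ : ∀ k, ε k ≤ ρ := fun k => by
    refine mul_le_of_le_one_right hρ.le ?_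
    rw [div_le_one (by positivity)]
    linarith [(Nat.cast_nonneg k : (0 : ℝ) ≤ k)]
  have hlim : Tendsto ε atTop (𝓝[>] 0) := by
    refine tendsto_nhdsWithin_iff.2 ⟨?_, Eventually.of_forall hε0⟩
    have := tendsto_one_div_add_atTop_nhds_zero_nat.const_mul ρ
    rwa [mul_zero] at this
  have hder := fun k => hasFDerivAt_prox hmq hρ (σ := lowered ρ σ (ε k))
    (fun i => by
      by_cases hi : σ i = ρ
      · rw [lowered_of_eq hi]; exact sub_nonneg.2 (hερ k)
      · rw [lowered_of_ne hi]; exact hσ i)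
    (fun i => lowered_ne (hε0 k)) hU hV
  refine ⟨fun k => conjMap U V (diagZero q (lowered ρ σ (ε k))),
    fun k => (hder k).differentiableAt, ?_, ?_⟩
  · refine ((conjMap U V).continuous.comp continuous_diagZero).tendsto σ |>.comp ?_
    exact tendsto_pi_nhds.2 fun i => (tendsto_lowered i).comp hlim
  · simp only [fun k => (hder k).fderiv]
    have h1 := ((mixMap hmq).continuous.tendsto _).comp
      ((tendsto_gammaPair (q := q) hmq hρ hσ).comp hlim)
    have h2 : Continuous fun L : NormedCLM (Matrix (Fin m) (Fin q) ℝ) (Matrix (Fin m) (Fin q) ℝ) =>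
        (conjMap U V).comp (L.comp (conjMap Uᵀ Vᵀ)) :=
      continuous_const.clm_comp (continuous_id.clm_comp continuous_const)
    exact (h2.tendsto _).comp h1

theorem stronglySemismooth_prox (hmq : m ≤ q) (hρ : 0 < ρ) :
    StronglySemismooth (prox (fun B : Matrix (Fin m) (Fin q) ℝ => ρ * nuclearNorm B))
      (clarkeJacobian (prox (fun B : Matrix (Fin m) (Fin q) ℝ => ρ * nuclearNorm B))) where
  locallyLipschitz := (lipschitzWith_prox hmq hρ).locallyLipschitz
  nonempty X := by
    obtain ⟨U, hU, V, hV, σ, hσ, rfl⟩ := exists_svd hmq X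
    exact ⟨_, subset_convexHull ℝ _ (conj_mixMap_mem_bSubdifferential hmq hρ hσ hU hV)⟩
  isCompact := isCompact_clarkeJacobian (lipschitzWith_prox hmq hρ)
  upperSemicontinuous := upperHemicontinuous_clarkeJacobian (lipschitzWith_prox hmq hρ)
  stronglySemismoothAt := stronglySemismoothAt_prox hmq hρ

theorem gammaAA_isSymm (ρ : ℝ) (σ : Fin m → ℝ) : (gammaAA ρ σ).IsSymm := by
  ext i j
  simp only [Matrix.transpose_apply, gammaAA_apply]
  rcases lt_trichotomy (σ i) ρ with hi | hi | hi <;>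
    rcases lt_trichotomy (σ j) ρ with hj | hj | hj <;>
    split_ifs <;> first | rfl | contradiction | (exfalso; linarith)

theorem gammaAG_isSymm (ρ : ℝ) (σ : Fin m → ℝ) : (gammaAG ρ σ).IsSymm := by
  ext i j
  simp only [Matrix.transpose_apply, gammaAG_apply]
  by_cases hi : σ i > ρ <;> by_cases hj : σ j > ρ <;> simp only [hi, hj, if_true, if_false]
  -- Only the block with both singular values above `ρ` is not symmetric by definition.
  rw [omega, omega, add_comm (σ i) (σ j), max_eq_left (sub_pos.2 hi).le,
    max_eq_left (sub_pos.2 hj).le, add_comm]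

theorem sum_eq_sum_castLE_add (hmq : m ≤ q) (f : Fin q → ℝ) :
    ∑ j, f j = ∑ j, f (Fin.castLE hmq j) +
      ∑ j, f (Fin.cast (Nat.add_sub_of_le hmq) (Fin.natAdd m j)) := by
  rw [← (finCongr (Nat.add_sub_of_le hmq)).sum_comp f, Fin.sum_univ_add]
  rfl

/-- The map `mixMap` with the coefficients `gammaPair` in terms of the blocks `H = [H₁ H₂]` and
`V = [V₁ V₂]`. -/
theorem mixMap_gammaPair_mul_transpose (hmq : m ≤ q) (V : Matrix (Fin q) (Fin q) ℝ)
    (H : Matrix (Fin m) (Fin q) ℝ) (H₁ : Matrix (Fin m) (Fin m) ℝ)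
    (H₂ : Matrix (Fin m) (Fin (q - m)) ℝ) (h₁ : ∀ i j, H₁ i j = H i (Fin.castLE hmq j))
    (h₂ : ∀ i j, H₂ i j = H i (Fin.cast (Nat.add_sub_of_le hmq) (Fin.natAdd m j))) :
    mixMap hmq (gammaPair q ρ σ) H * Vᵀ =
      (gammaAA ρ σ ⊙ ((1 / 2 : ℝ) • (H₁ + H₁ᵀ)) +
        gammaAG ρ σ ⊙ ((1 / 2 : ℝ) • (H₁ - H₁ᵀ))) * (leftCols hmq V)ᵀ +
      (gammaAB q ρ σ ⊙ H₂) * (rightCols hmq V)ᵀ := by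
  ext i c
  rw [Matrix.add_apply, Matrix.mul_apply, Matrix.mul_apply, Matrix.mul_apply,
    sum_eq_sum_castLE_add hmq]
  congr 1
  · refine Finset.sum_congr rfl fun j _ => ?_
    rw [mixMap_castLE, gammaPair_fst_castLE, ← h₁, ← h₁]
    simp only [gammaPair, leftCols, Matrix.transpose_apply, Matrix.of_apply, Matrix.add_apply,
      Matrix.hadamard_apply, Matrix.smul_apply, Matrix.sub_apply, smul_eq_mul]
    ring
  · refine Finset.sum_congr rfl fun j _ => ?_
    have hj : m ≤ (Fin.cast (Nat.add_sub_of_le hmq) (Fin.natAdd m j) : Fin q) := by simp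
    rw [mixMap_of_le _ _ _ _ hj, gammaPair_fst_of_le _ _ _ hj, ← h₂]
    simp only [gammaAB, rightCols, Matrix.transpose_apply, Matrix.of_apply,
      Matrix.hadamard_apply]

end Element

end NuclearProx

end

theorem proposition1 (m q : ℕ) (hmq : m ≤ q) (ρ : ℝ) (hρ : 0 < ρ)
    (Y : Matrix (Fin m) (Fin q) ℝ)
    (U : Matrix (Fin m) (Fin m) ℝ) (hU : U ∈ Matrix.orthogonalGroup (Fin m) ℝ)
    (V : Matrix (Fin q) (Fin q) ℝ) (hV : V ∈ Matrix.orthogonalGroup (Fin q) ℝ)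
    (σ : Fin m → ℝ) (hσ : Antitone σ) (hσ0 : ∀ i, 0 ≤ σ i)
    (hY : Y = U * diagZero q σ * Vᵀ) :
    -- the proximal mapping of `ρ ‖·‖_*` is well defined
    (∀ X : Matrix (Fin m) (Fin q) ℝ,
      (∃! Z, IsProxPoint (fun B => ρ * nuclearNorm B) X Z) ∧
      IsProxPoint (fun B => ρ * nuclearNorm B) X (prox (fun B => ρ * nuclearNorm B) X)) ∧
    -- (a) singular value soft-thresholding
    prox (fun B : Matrix (Fin m) (Fin q) ℝ => ρ * nuclearNorm B) Y =
      U * diagZero q (fun i => max (σ i - ρ) 0) * Vᵀ ∧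
    -- (b) strong semismoothness everywhere
    StronglySemismooth (prox (fun B : Matrix (Fin m) (Fin q) ℝ => ρ * nuclearNorm B))
      (clarkeJacobian (prox (fun B : Matrix (Fin m) (Fin q) ℝ => ρ * nuclearNorm B))) ∧
    -- (c) an explicit element of the Clarke generalized Jacobian
    (gammaAA ρ σ).IsSymm ∧ (gammaAG ρ σ).IsSymm ∧
    ∃ W ∈ clarkeJacobian (prox (fun B : Matrix (Fin m) (Fin q) ℝ => ρ * nuclearNorm B)) Y,
      ∀ H : Matrix (Fin m) (Fin q) ℝ,
        let V₁ := leftCols hmq V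
        let V₂ := rightCols hmq V
        let H₁ := Uᵀ * H * V₁
        let H₂ := Uᵀ * H * V₂
        W H = U * ((gammaAA ρ σ ⊙ ((1 / 2 : ℝ) • (H₁ + H₁ᵀ)) +
            gammaAG ρ σ ⊙ ((1 / 2 : ℝ) • (H₁ - H₁ᵀ))) * V₁ᵀ +
          (gammaAB q ρ σ ⊙ H₂) * V₂ᵀ) := by
  have hYc : Y = conjMap U V (diagZero q σ) := hY
  refine ⟨prox_wellDefined hmq hρ, ?_, stronglySemismooth_prox hmq hρ, gammaAA_isSymm ρ σ,
    gammaAG_isSymm ρ σ, _,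
    subset_convexHull ℝ _ (hYc ▸ conj_mixMap_mem_bSubdifferential hmq hρ hσ0 hU hV),
    fun H => ?_⟩
  · rw [hY]
    exact (isProxCertificate_of_svd hmq hρ hU hV hσ0).prox_eq hρ
  · have h := mixMap_gammaPair_mul_transpose (ρ := ρ) (σ := σ) hmq V (conjMap Uᵀ Vᵀ H)
      (Uᵀ * H * leftCols hmq V) (Uᵀ * H * rightCols hmq V)
      (fun i j => by rw [conjMap_apply, Matrix.transpose_transpose]; rfl)
      (fun i j => by rw [conjMap_apply, Matrix.transpose_transpose]; rfl)
    change U * mixMap hmq (gammaPair q ρ σ) (conjMap Uᵀ Vᵀ H) * Vᵀ = U * _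
    rw [Matrix.mul_assoc, h]
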